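/- Let $n\ge 1$ and let $D\subset\mathbb C^n$ be a bounded, polynomially convex Reinhardt domain, that is, a nonempty bounded connected open set which is invariant under all rotations $(z_1,\dots,z_n)\mapsto(e^{it_1}z_1,\dots,e^{it_n}z_n)$, $t_k\in\mathbb R$, and contains the polynomial hull $\{z\in\mathbb C^n:\ |p(z)|\le\sup_K|p|\text{ for all polynomials }p\}$ of each compact $K\subset D$ (in particular $0\in D$). Let $G$ be the pluricomplex Green function of $D$ with pole at $0$: $G(z)$ is the supremum of $u(z)$ over all negative plurisubharmonic functions $u$ on $D$ with $u(z)\le\log|z|+O(1)$ as $z\to 0$. Let $V$ be the Green function for $\overline D$ with pole at infinity: for $z\in\mathbb C^n$, $V(z)$ is the supremum of $u(z)$ over all plurisubharmonic functions $u$ on $\mathbb C^n$ such that $u\le 0$ on $\overline D$ and $u(z)\le\log(1+|z|)+C$ on $\mathbb C^n$ for some constant $C$ depending on $u$. Then there are positive integers $q_s$ and polynomial mappings $P^{(s)}=(P^{(s)}_1,\dots,P^{(s)}_n):\mathbb C^n\to\mathbb C^n$, $s=0,1,2,\dots$, such that for each $s$ all components $P^{(s)}_k$ are homogeneous polynomials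 of the same degree $q_s$ and their only common zero is $0$, and such that the functions $$v_s=\frac1{q_s}\max_{1\le k\le n}\log|P^{(s)}_k|\qquad(\log 0=-\infty)$$ have the following properties: $v_s$ converges to $G$ uniformly on $D\setminus\{0\}$, and $\max\{v_s,0\}$ converges to $V$ uniformly on $\mathbb C^n$. (All these functions are finite on the sets in question.) -/

import Mathlib

open Set Filter Topology MeasureTheory
open scoped ENNReal

namespace PluriGreen

noncomputable section

/- The space `ℂⁿ` is `Fin n → ℂ`. Its norm is `max_k |z_k|`; every use of the norm below (bounded
sets, topology, estimates up to an additive constant of `log ‖z‖`) is independent of the choice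
of a norm on `ℂⁿ`. -/

/-- The mean over the circle `θ ↦ a + e^{iθ} b` of a function with values in `[-∞, ∞]`, as the
mean of the positive part minus the mean of the negative part. For a function that is upper
semicontinuous and `< ∞` on the circle, the mean of the positive part is finite, so the difference
is the usual integral mean in `[-∞, ∞)`. -/
def circleMean {n : ℕ} (u : (Fin n → ℂ) → EReal) (a b : Fin n → ℂ) : EReal :=
  ((⨍⁻ θ in Ioc (0 : ℝ) (2 * Real.pi), (u (a + circleMap 0 1 θ • b)).toENNReal ∂volume : ℝ≥0∞) : EReal) -
  ((⨍⁻ θ in Ioc (0 : ℝ) (2 * Real.pi), (-u (a + circleMap 0 1 θ • b)).toENNReal ∂volume : ℝ≥0∞) : EReal)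

/-- `u` is plurisubharmonic on the (open) set `D`: it takes values in `[-∞, ∞)`, is upper
semicontinuous, and satisfies the sub-mean value inequality on each closed disc
`{a + ζ b : |ζ| ≤ 1}` in a complex line that is contained in `D`. The function `-∞` is allowed. -/
structure PSHOn {n : ℕ} (u : (Fin n → ℂ) → EReal) (D : Set (Fin n → ℂ)) : Prop where
  lt_top : ∀ z ∈ D, u z < ⊤
  usc : UpperSemicontinuousOn u D
  submean : ∀ a b : Fin n → ℂ, (∀ ζ : ℂ, ‖ζ‖ ≤ 1 → a + ζ • b ∈ D) → u a ≤ circleMean u a b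

/-- The negative plurisubharmonic functions `u` on `D` with `u z ≤ log |z - a| + O(1)`
as `z → a`. -/
def greenClass {n : ℕ} (D : Set (Fin n → ℂ)) (a : Fin n → ℂ) : Set ((Fin n → ℂ) → EReal) :=
  {u | PSHOn u D ∧ (∀ z ∈ D, u z < 0) ∧
    ∃ C : ℝ, ∀ᶠ z in 𝓝[≠] a, u z ≤ ((Real.log ‖z - a‖ + C : ℝ) : EReal)}

/-- The pluricomplex Green function of `D` with pole at `a` (meaningful at points of `D`). -/
def greenFunction {n : ℕ} (D : Set (Fin n → ℂ)) (a z : Fin n → ℂ) : EReal :=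
  ⨆ u ∈ greenClass D a, u z

/-- The Lelong class: plurisubharmonic functions on `ℂⁿ` of at most logarithmic growth. -/
def lelongClass (n : ℕ) : Set ((Fin n → ℂ) → EReal) :=
  {u | PSHOn u univ ∧ ∃ C : ℝ, ∀ z, u z ≤ ((Real.log (1 + ‖z‖) + C : ℝ) : EReal)}

/-- The pluricomplex Green function of `K` with pole at infinity: the upper envelope of the
functions of the Lelong class that are `≤ 0` on `K`. -/
def greenFunctionInfty {n : ℕ} (K : Set (Fin n → ℂ)) (z : Fin n → ℂ) : EReal :=
  ⨆ u ∈ {u ∈ lelongClass n | ∀ w ∈ K, u w ≤ 0}, u z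

/-- The polynomial hull `{z : |p(z)| ≤ sup_K |p| for all polynomials p}` of a compact set `K`. -/
def polynomialHull {n : ℕ} (K : Set (Fin n → ℂ)) : Set (Fin n → ℂ) :=
  {z | ∀ (p : MvPolynomial (Fin n) ℂ) (M : ℝ),
    (∀ w ∈ K, ‖MvPolynomial.eval w p‖ ≤ M) → ‖MvPolynomial.eval z p‖ ≤ M}

/-- An open set is polynomially convex if it contains the polynomial hull of each of its compact
subsets. -/
def IsPolynomiallyConvex {n : ℕ} (D : Set (Fin n → ℂ)) : Prop :=
  ∀ K ⊆ D, IsCompact K → polynomialHull K ⊆ D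

/-- Invariance under all rotations `z_k ↦ e^{i t_k} z_k` of the coordinates. -/
def IsReinhardt {n : ℕ} (D : Set (Fin n → ℂ)) : Prop :=
  ∀ z ∈ D, ∀ w : Fin n → ℂ, (∀ k, ‖w k‖ = ‖z k‖) → w ∈ D

/-- `q⁻¹ max_k log |P_k(z)|`, with `log 0 = -∞`. -/
def logMax {n : ℕ} (q : ℕ) (P : Fin n → MvPolynomial (Fin n) ℂ) (z : Fin n → ℂ) : EReal :=
  (((q : ℝ)⁻¹ : ℝ) : EReal) * ⨆ k, ENNReal.log ‖MvPolynomial.eval z (P k)‖ₑ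

/-- `g` and all `f s` are finite on `S`, and `f s` converges to `g` uniformly on `S`. -/
def ConvergesUniformlyOn {X : Type*} (f : ℕ → X → EReal) (g : X → EReal) (S : Set X) : Prop :=
  (∀ z ∈ S, g z ≠ ⊤ ∧ g z ≠ ⊥) ∧ (∀ s, ∀ z ∈ S, f s z ≠ ⊤ ∧ f s z ≠ ⊥) ∧
    TendstoUniformlyOn (fun s z => (f s z).toReal) (fun z => (g z).toReal) atTop S

end

end PluriGreen

namespace PluriGreen

/-! Let h = `gauge D`. Monomials already separate points from compact Reinhardt sets, so D is
complete Reinhardt and h is, up to a factor κ > 1 near 1, a finite maximum of q-th roots of moduli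
of monomials of one degree q. Logarithms of such monomials are plurisubharmonic competitors, and the
maximum principle on annuli in complex lines through 0 gives the opposite estimates: G = log h on D
\ {0} and V = max(log h, 0) (`greenFunction_eq`, `greenFunctionInfty_eq`).

It remains to pass from N monomials to n polynomials (`exists_polynomials`). After a generic small
change of the coefficients, no n + 1 of the monomials have equal nonzero moduli at a point, because
n + 1 exponent vectors in ℝⁿ are dependent. By compactness and homogeneity, at each point at most n
monomials y_j are then comparable to the largest. So for large m the n sums ∑ j^k y_j^m, k < n,
cannot all be small: Lagrange interpolation at these at most n indices isolates the largest term.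
The constants lost disappear in the qm-th root. All bounds are multiplicative in h on ℂⁿ, hence
uniform after taking logarithms. -/

/-- The norm of the monomial with coefficient of norm `c` and exponent `A`. -/
noncomputable def monomialNorm {n : ℕ} (c : ℝ) (A : Fin n → ℕ) (z : Fin n → ℂ) : ℝ :=
  c * ∏ k, ‖z k‖ ^ A k

/-! ### Separation from Reinhardt sets by monomials. -/

theorem sum_pow_rootsOfUnity {L : ℕ} {ω : ℂ} (hω : IsPrimitiveRoot ω L) (hL : 0 < L) {a b : ℕ}
    (ha : a < L) (hb : b < L) :
    ∑ j : Fin L, (ω ^ (j : ℕ)) ^ a * ((ω ^ (j : ℕ)) ^ b)⁻¹ = if a = b then (L : ℂ) else 0 := by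
  have h0 : ω ≠ 0 := hω.ne_zero hL.ne'
  have hx : ∀ j : ℕ, (ω ^ j) ^ a * ((ω ^ j) ^ b)⁻¹ = (ω ^ a * (ω ^ b)⁻¹) ^ j := by
    intro j
    rw [mul_pow, inv_pow, ← pow_mul, ← pow_mul, ← pow_mul, ← pow_mul, mul_comm j a, mul_comm j b]
  rw [Fin.sum_univ_eq_sum_range (fun j => (ω ^ j) ^ a * ((ω ^ j) ^ b)⁻¹) L]
  simp only [hx]
  split_ifs with hab
  · subst hab
    rw [mul_inv_cancel₀ (pow_ne_zero _ h0)]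
    simp
  · have hne : ω ^ a * (ω ^ b)⁻¹ ≠ 1 := by
      intro h
      rw [mul_inv_eq_one₀ (pow_ne_zero _ h0)] at h
      exact hab (hω.pow_inj ha hb h)
    rw [geom_sum_eq hne, mul_pow, inv_pow, ← pow_mul, ← pow_mul, mul_comm a, mul_comm b, pow_mul,
      pow_mul, hω.pow_eq_one]
    simp

/-- Cauchy's estimate on a torus. -/
theorem norm_coeff_mul_le {n : ℕ} (p : MvPolynomial (Fin n) ℂ) (z : Fin n → ℂ) {M : ℝ}
    (hM : ∀ w : Fin n → ℂ, (∀ k, ‖w k‖ = ‖z k‖) → ‖MvPolynomial.eval w p‖ ≤ M)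
    (A : Fin n →₀ ℕ) (hA : A ∈ p.support) :
    ‖MvPolynomial.coeff A p‖ * ∏ k, ‖z k‖ ^ A k ≤ M := by
  -- L exceeds every exponent of p, so the L-th roots of unity tell exponents apart, and a finite
  -- sum over L^n points of the torus extracts one coefficient exactly.
  set L := p.totalDegree + 1 with hLdef
  have hL : 0 < L := Nat.succ_pos _
  have hlt : ∀ d ∈ p.support, ∀ k, d k < L := by
    intro d hd k
    have h1 := MvPolynomial.le_totalDegree hd
    have h2 : d k ≤ d.sum fun _ e => e := by
      rw [Finsupp.sum_fintype _ _ (by simp)]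
      exact Finset.single_le_sum (f := fun i => d i) (fun _ _ => Nat.zero_le _) (Finset.mem_univ k)
    omega
  have hω := Complex.isPrimitiveRoot_exp L hL.ne'
  set ω := Complex.exp (2 * Real.pi * Complex.I / L)
  have hn1 : ‖ω‖ = 1 := hω.norm'_eq_one hL.ne'
  have key : ∑ j : Fin n → Fin L,
      MvPolynomial.eval (fun k => ω ^ (j k : ℕ) * z k) p * ∏ k, ((ω ^ (j k : ℕ)) ^ A k)⁻¹
      = (L : ℂ) ^ n * (MvPolynomial.coeff A p * ∏ k, z k ^ A k) := by
    have h1 : ∀ j : Fin n → Fin L,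
        MvPolynomial.eval (fun k => ω ^ (j k : ℕ) * z k) p * ∏ k, ((ω ^ (j k : ℕ)) ^ A k)⁻¹
        = ∑ d ∈ p.support, (MvPolynomial.coeff d p * ∏ k, z k ^ d k) *
          ∏ k, ((ω ^ (j k : ℕ)) ^ d k * ((ω ^ (j k : ℕ)) ^ A k)⁻¹) := by
      intro j
      rw [MvPolynomial.eval_eq', Finset.sum_mul]
      refine Finset.sum_congr rfl fun d _ => ?_
      simp only [mul_pow, Finset.prod_mul_distrib]
      ring
    simp only [h1]
    rw [Finset.sum_comm]
    have h2 : ∀ d ∈ p.support, ∑ j : Fin n → Fin L, (MvPolynomial.coeff d p * ∏ k, z k ^ d k) *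
          ∏ k, ((ω ^ (j k : ℕ)) ^ d k * ((ω ^ (j k : ℕ)) ^ A k)⁻¹)
        = if d = A then (L : ℂ) ^ n * (MvPolynomial.coeff A p * ∏ k, z k ^ A k) else 0 := by
      intro d hd
      rw [← Finset.mul_sum, ← Fintype.prod_sum
        (fun k (j : Fin L) => (ω ^ (j : ℕ)) ^ d k * ((ω ^ (j : ℕ)) ^ A k)⁻¹)]
      have h3 : ∀ k, ∑ j : Fin L, (ω ^ (j : ℕ)) ^ d k * ((ω ^ (j : ℕ)) ^ A k)⁻¹
          = if d k = A k then (L : ℂ) else 0 :=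
        fun k => sum_pow_rootsOfUnity hω hL (hlt d hd k) (hlt A hA k)
      simp only [h3]
      split_ifs with hdA
      · subst hdA
        simp [mul_comm]
      · obtain ⟨k, hk⟩ : ∃ k, d k ≠ A k := by
          by_contra! h
          exact hdA (Finsupp.ext h)
        have h4 : ∏ k, (if d k = A k then (L : ℂ) else 0) = 0 :=
          Finset.prod_eq_zero (Finset.mem_univ k) (if_neg hk)
        rw [h4, mul_zero]
    rw [Finset.sum_congr rfl h2, Finset.sum_ite_eq' p.support A, if_pos hA]
  have hle : ‖∑ j : Fin n → Fin L,
      MvPolynomial.eval (fun k => ω ^ (j k : ℕ) * z k) p * ∏ k, ((ω ^ (j k : ℕ)) ^ A k)⁻¹‖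
      ≤ (L : ℝ) ^ n * M := by
    refine (norm_sum_le _ _).trans ?_
    have h1 : ∀ j ∈ (Finset.univ : Finset (Fin n → Fin L)),
        ‖MvPolynomial.eval (fun k => ω ^ (j k : ℕ) * z k) p * ∏ k, ((ω ^ (j k : ℕ)) ^ A k)⁻¹‖
          ≤ M := by
      intro j _
      rw [norm_mul, norm_prod]
      simp only [norm_inv, norm_pow, hn1, one_pow, inv_one, Finset.prod_const_one, mul_one]
      exact hM _ fun k => by simp [hn1]
    refine (Finset.sum_le_card_nsmul _ _ _ h1).trans (le_of_eq ?_)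
    simp
  rw [key, norm_mul, norm_pow, Complex.norm_natCast, norm_mul, norm_prod] at hle
  simp only [norm_pow] at hle
  exact le_of_mul_le_mul_left hle (by positivity)

/-- What matters is that the bound is polynomial in N, so it loses against any exponential R^N with
R > 1. -/
theorem card_support_pow_le {n : ℕ} (p : MvPolynomial (Fin n) ℂ) (N : ℕ) :
    (p ^ N).support.card ≤ (N * p.totalDegree + 1) ^ n := by
  have : (p ^ N).support.card ≤
      (Fintype.piFinset fun _ : Fin n => Finset.range (N * p.totalDegree + 1)).card := by
    refine Finset.card_le_card_of_injOn (fun d => (d : Fin n → ℕ)) ?_ ?_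
    · intro d hd
      simp only [Fintype.coe_piFinset, Set.mem_pi, Finset.coe_range, Set.mem_Iio]
      intro k _
      have h1 := MvPolynomial.le_totalDegree hd
      have h2 : d k ≤ d.sum fun _ e => e := by
        rw [Finsupp.sum_fintype _ _ (by simp)]
        exact Finset.single_le_sum (f := fun i => d i) (fun _ _ => Nat.zero_le _)
          (Finset.mem_univ k)
      have h3 := MvPolynomial.totalDegree_pow p N
      omega
    · exact DFunLike.coe_injective.injOn
  simpa using this

/-- If a polynomial separates a point `w` from a Reinhardt set, then so does a monomial. -/
theorem exists_monomialNorm_of_polynomial {n : ℕ} {K : Set (Fin n → ℂ)} (hK : IsReinhardt K)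
    (p : MvPolynomial (Fin n) ℂ) {M : ℝ} (hM0 : 0 ≤ M)
    (hM : ∀ z ∈ K, ‖MvPolynomial.eval z p‖ ≤ M)
    {w : Fin n → ℂ} (hw : M < ‖MvPolynomial.eval w p‖) :
    ∃ (c : ℝ) (A : Fin n → ℕ), 0 < c ∧ (∀ z ∈ K, monomialNorm c A z ≤ 1) ∧
      1 < monomialNorm c A w := by
  -- M may be 0; the intermediate M' is positive and can serve as a divisor.
  obtain ⟨M', hMM', hM'w⟩ := exists_between hw
  have hM'0 : 0 < M' := hM0.trans_lt hMM'
  set R := ‖MvPolynomial.eval w p‖ / M' with hR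
  have hR1 : 1 < R := (one_lt_div hM'0).2 hM'w
  obtain ⟨N, hN1, hN⟩ : ∃ N : ℕ, 1 ≤ N ∧
      (((N * p.totalDegree + 1) ^ n : ℕ) : ℝ) < R ^ N := by
    have ht := tendsto_pow_const_div_const_pow_of_one_lt n hR1
    have hpos : (0 : ℝ) < 1 / ((p.totalDegree + 1 : ℕ) : ℝ) ^ n := by positivity
    obtain ⟨N, h1, h2⟩ := ((ht.eventually (gt_mem_nhds hpos)).and (eventually_ge_atTop 1)).exists
    refine ⟨N, h2, ?_⟩
    rw [div_lt_div_iff₀ (by positivity) (by positivity), one_mul, ← mul_pow] at h1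
    refine lt_of_le_of_lt ?_ h1
    push_cast
    gcongr
    have : (1 : ℝ) ≤ N := by exact_mod_cast h2
    nlinarith
  have hbound : ∀ z ∈ K, ∀ A ∈ (p ^ N).support,
      ‖MvPolynomial.coeff A (p ^ N)‖ * ∏ k, ‖z k‖ ^ A k ≤ M' ^ N := by
    intro z hz A hA
    refine norm_coeff_mul_le (p ^ N) z (fun w hw => ?_) A hA
    rw [map_pow, norm_pow]
    exact pow_le_pow_left₀ (norm_nonneg _) ((hM w (hK z hz w hw)).trans hMM'.le) N
  -- If all terms of p^N were at most M'^N at w, then R^N would be at most the number of terms.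
  obtain ⟨A, hA, hAw⟩ : ∃ A ∈ (p ^ N).support,
      M' ^ N < ‖MvPolynomial.coeff A (p ^ N)‖ * ∏ k, ‖w k‖ ^ A k := by
    by_contra! h
    have h1 : ‖MvPolynomial.eval w (p ^ N)‖ ≤ (p ^ N).support.card • M' ^ N := by
      rw [MvPolynomial.eval_eq']
      refine (norm_sum_le _ _).trans (Finset.sum_le_card_nsmul _ _ _ fun d hd => ?_)
      rw [norm_mul, norm_prod]
      simpa only [norm_pow] using h d hd
    rw [map_pow, norm_pow, nsmul_eq_mul] at h1
    have h2 : ‖MvPolynomial.eval w p‖ = R * M' := by rw [hR]; field_simp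
    rw [h2, mul_pow] at h1
    have h3 := le_of_mul_le_mul_right h1 (by positivity)
    have h4 : ((p ^ N).support.card : ℝ) ≤ (((N * p.totalDegree + 1) ^ n : ℕ) : ℝ) :=
      Nat.cast_le.2 (card_support_pow_le p N)
    linarith
  refine ⟨‖MvPolynomial.coeff A (p ^ N)‖ / M' ^ N, A, ?_, fun z hz => ?_, ?_⟩
  · exact div_pos (norm_pos_iff.2 (MvPolynomial.mem_support_iff.1 hA)) (by positivity)
  · rw [monomialNorm, div_mul_eq_mul_div, div_le_one (by positivity)]
    exact hbound z hz A hA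
  · rw [monomialNorm, div_mul_eq_mul_div, one_lt_div (by positivity)]
    exact hAw

theorem continuous_monomialNorm {n : ℕ} (c : ℝ) (A : Fin n → ℕ) :
    Continuous (monomialNorm c A) := by
  unfold monomialNorm
  fun_prop

theorem monomialNorm_nonneg {n : ℕ} {c : ℝ} (hc : 0 ≤ c) (A : Fin n → ℕ) (z : Fin n → ℂ) :
    0 ≤ monomialNorm c A z := by
  unfold monomialNorm
  positivity

theorem monomialNorm_smul {n : ℕ} (c : ℝ) (A : Fin n → ℕ) (t : ℝ) (ht : 0 ≤ t) (z : Fin n → ℂ) :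
    monomialNorm c A (t • z) = t ^ (∑ k, A k) * monomialNorm c A z := by
  simp only [monomialNorm, Pi.smul_apply, norm_smul, mul_pow, Finset.prod_mul_distrib,
    Finset.prod_pow_eq_pow_sum, Real.norm_of_nonneg ht]
  ring

theorem monomialNorm_pow {n : ℕ} (c : ℝ) (A : Fin n → ℕ) (m : ℕ) (z : Fin n → ℂ) :
    monomialNorm c A z ^ m = monomialNorm (c ^ m) (fun k => m * A k) z := by
  simp only [monomialNorm, mul_pow, ← Finset.prod_pow, ← pow_mul]
  simp only [mul_comm m]

theorem monomialNorm_mono {n : ℕ} {c : ℝ} (hc : 0 ≤ c) (A : Fin n → ℕ) {z w : Fin n → ℂ}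
    (h : ∀ k, ‖z k‖ ≤ ‖w k‖) : monomialNorm c A z ≤ monomialNorm c A w := by
  unfold monomialNorm
  gcongr with k
  exact h k

theorem isCompact_torus {n : ℕ} (z : Fin n → ℂ) :
    IsCompact {w : Fin n → ℂ | ∀ k, ‖w k‖ = ‖z k‖} := by
  refine Metric.isCompact_of_isClosed_isBounded ?_ ?_
  · simp only [ofPred_forall]
    exact isClosed_iInter fun k => isClosed_eq (by fun_prop) continuous_const
  · refine (Metric.isBounded_closedBall (x := (0 : Fin n → ℂ)) (r := ‖z‖)).subset fun w hw => ?_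
    rw [mem_closedBall_zero_iff, pi_norm_le_iff_of_nonneg (norm_nonneg _)]
    intro k
    rw [hw k]
    exact norm_le_pi_norm z k

/-- A point outside a polynomially convex domain is separated by a monomial from a given compact
Reinhardt subset. -/
theorem IsPolynomiallyConvex.exists_monomialNorm {n : ℕ} {D : Set (Fin n → ℂ)}
    (hpc : IsPolynomiallyConvex D) {K : Set (Fin n → ℂ)} (hKD : K ⊆ D) (hK : IsCompact K)
    (hKR : IsReinhardt K) (hne : K.Nonempty) {w : Fin n → ℂ} (hw : w ∉ D) :
    ∃ (c : ℝ) (A : Fin n → ℕ), 0 < c ∧ (∀ z ∈ K, monomialNorm c A z ≤ 1) ∧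
      1 < monomialNorm c A w := by
  have h1 : w ∉ polynomialHull K := fun h => hw (hpc K hKD hK h)
  simp only [polynomialHull, mem_ofPred_eq, not_forall, not_le] at h1
  obtain ⟨p, M, hM, hlt⟩ := h1
  obtain ⟨z, hz⟩ := hne
  exact exists_monomialNorm_of_polynomial hKR p ((norm_nonneg _).trans (hM z hz)) hM hlt

/-- Moduli of monomials increase with each |z_k|, so no monomial can separate w from the torus
through z. -/
theorem IsPolynomiallyConvex.mem_of_norm_le {n : ℕ} {D : Set (Fin n → ℂ)}
    (hpc : IsPolynomiallyConvex D) (hR : IsReinhardt D) {z w : Fin n → ℂ} (hz : z ∈ D)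
    (h : ∀ k, ‖w k‖ ≤ ‖z k‖) : w ∈ D := by
  by_contra hw
  obtain ⟨c, A, hc, h1, h2⟩ := hpc.exists_monomialNorm
    (K := {w : Fin n → ℂ | ∀ k, ‖w k‖ = ‖z k‖}) (fun w hw => hR z hz w hw) (isCompact_torus z)
    (fun x hx y hy k => (hy k).trans (hx k)) ⟨z, fun _ => rfl⟩ hw
  exact absurd (h2.trans_le (monomialNorm_mono hc.le A h)) (not_lt.2 (h1 z fun _ => rfl))

/-! ### The Minkowski functional and its approximation by monomials. -/

/-- The properties of the Minkowski functional of a bounded complete Reinhardt domain. -/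
structure IsReinhardtGauge {n : ℕ} (D : Set (Fin n → ℂ)) (h : (Fin n → ℂ) → ℝ) : Prop where
  continuous : Continuous h
  smul : ∀ (t : ℂ) (z : Fin n → ℂ), h (t • z) = ‖t‖ * h z
  mono : ∀ z w : Fin n → ℂ, (∀ k, ‖w k‖ ≤ ‖z k‖) → h w ≤ h z
  pos : ∀ z, z ≠ 0 → 0 < h z
  lt_one_iff : ∀ z, h z < 1 ↔ z ∈ D
  exists_le : ∃ C, 0 < C ∧ ∀ z, h z ≤ C * ‖z‖

/-- D need not be convex, so continuity is proved by hand: the upper half from openness of D, the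
lower half from monotonicity, since |w_k| ≥ b|z_k| for all k when b < 1 and w is near z. -/
theorem isReinhardtGauge_gauge {n : ℕ} {D : Set (Fin n → ℂ)} (hopen : IsOpen D)
    (hne : D.Nonempty) (hbdd : Bornology.IsBounded D)
    (hcomp : ∀ z ∈ D, ∀ w : Fin n → ℂ, (∀ k, ‖w k‖ ≤ ‖z k‖) → w ∈ D) :
    IsReinhardtGauge D (gauge D) := by
  have h0 : (0 : Fin n → ℂ) ∈ D := by
    obtain ⟨z, hz⟩ := hne
    exact hcomp z hz 0 fun k => by simp
  have hnhds : D ∈ 𝓝 (0 : Fin n → ℂ) := hopen.mem_nhds h0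
  have habs : Absorbent ℝ D := absorbent_nhds_zero hnhds
  have hbal : Balanced ℂ D := by
    rintro t ht _ ⟨z, hz, rfl⟩
    refine hcomp z hz _ fun k => ?_
    simp only [Pi.smul_apply, norm_smul]
    exact mul_le_of_le_one_left (norm_nonneg _) ht
  have hsmul : ∀ (t : ℂ) (z : Fin n → ℂ), gauge D (t • z) = ‖t‖ * gauge D z :=
    fun t z => gauge_smul hbal t z
  have hlt : ∀ z, gauge D z < 1 ↔ z ∈ D := by
    refine fun z => ⟨fun h => ?_, gauge_lt_one_of_mem_of_isOpen hopen⟩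
    obtain ⟨b, hb0, hb1, x, hx, rfl⟩ := exists_lt_of_gauge_lt habs h
    refine hcomp x hx _ fun k => ?_
    simp only [Pi.smul_apply, norm_smul, Real.norm_of_nonneg hb0.le]
    exact mul_le_of_le_one_left (norm_nonneg _) hb1.le
  have hmono : ∀ z w : Fin n → ℂ, (∀ k, ‖w k‖ ≤ ‖z k‖) → gauge D w ≤ gauge D z := by
    intro z w hzw
    refine le_of_forall_gt fun c hc => ?_
    obtain ⟨b, hb0, hb1, x, hx, rfl⟩ := exists_lt_of_gauge_lt habs hc
    refine lt_of_le_of_lt (gauge_le_of_mem hb0.le ?_) hb1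
    refine ⟨b⁻¹ • w, hcomp x hx _ fun k => ?_, smul_inv_smul₀ hb0.ne' w⟩
    have := hzw k
    simp only [Pi.smul_apply, norm_smul, norm_inv, Real.norm_of_nonneg hb0.le] at this ⊢
    rwa [inv_mul_le_iff₀ hb0]
  have hpos : ∀ z, z ≠ 0 → 0 < gauge D z := fun z hz =>
    (gauge_pos habs ((NormedSpace.isVonNBounded_iff ℝ).2 hbdd)).2 hz
  have hrsmul : ∀ (t : ℝ) (z : Fin n → ℂ), 0 ≤ t → gauge D (t • z) = t * gauge D z :=
    fun t z ht => gauge_smul_of_nonneg ht z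
  refine ⟨?_, hsmul, hmono, hpos, hlt, ?_⟩
  · rw [continuous_iff_continuousAt]
    intro z
    rw [ContinuousAt, tendsto_order]
    constructor
    · intro a ha
      have hev : ∀ b : ℝ, 0 < b → b < 1 → ∀ᶠ w in 𝓝 z, ∀ k, b * ‖z k‖ ≤ ‖w k‖ := by
        intro b hb0 hb1
        rw [eventually_all]
        intro k
        rcases (norm_nonneg (z k)).eq_or_lt' with hk | hk
        · simp [hk]
        · have : b * ‖z k‖ < ‖z k‖ := by nlinarith
          exact (((continuous_apply k).norm.tendsto z).eventually
            (lt_mem_nhds this)).mono fun w hw => le_of_lt hw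
      obtain ⟨b, hb0, hb1, hab⟩ : ∃ b : ℝ, 0 < b ∧ b < 1 ∧ a < b * gauge D z := by
        have ht : Tendsto (fun b : ℝ => b * gauge D z) (𝓝[<] 1) (𝓝 (1 * gauge D z)) :=
          ((continuous_id.mul continuous_const).tendsto 1).mono_left nhdsWithin_le_nhds
        rw [one_mul] at ht
        obtain ⟨b, h1, h2⟩ := ((ht.eventually (lt_mem_nhds ha)).and
          (Ioo_mem_nhdsLT (zero_lt_one' ℝ))).exists
        exact ⟨b, h2.1, h2.2, h1⟩
      filter_upwards [hev b hb0 hb1] with w hw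
      refine hab.trans_le ?_
      rw [← hrsmul b z hb0.le]
      refine hmono _ _ fun k => ?_
      simpa [norm_smul, abs_of_pos hb0] using hw k
    · intro a ha
      have ha0 : 0 < a := (gauge_nonneg z).trans_lt ha
      have : ∀ᶠ w in 𝓝 z, a⁻¹ • w ∈ D := by
        refine (continuous_const_smul a⁻¹).continuousAt.eventually_mem (hopen.mem_nhds ?_)
        rw [← hlt, hrsmul _ _ (inv_nonneg.2 ha0.le), inv_mul_lt_iff₀ ha0, mul_one]
        exact ha
      filter_upwards [this] with w hw
      rwa [← hlt, hrsmul _ _ (inv_nonneg.2 ha0.le), inv_mul_lt_iff₀ ha0, mul_one] at hw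
  · obtain ⟨r, hr, hball⟩ := Metric.mem_nhds_iff.1 hnhds
    refine ⟨r⁻¹, inv_pos.2 hr, fun z => ?_⟩
    rw [← div_eq_inv_mul, le_div_iff₀ hr, mul_comm]
    exact mul_gauge_le_norm hball

namespace IsReinhardtGauge

variable {n : ℕ} {D : Set (Fin n → ℂ)} {h : (Fin n → ℂ) → ℝ}

theorem map_zero (H : IsReinhardtGauge D h) : h 0 = 0 := by
  simpa using H.smul 0 0

theorem nonneg (H : IsReinhardtGauge D h) (z : Fin n → ℂ) : 0 ≤ h z := by
  rcases eq_or_ne z 0 with rfl | hz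
  · exact H.map_zero.ge
  · exact (H.pos z hz).le

theorem real_smul (H : IsReinhardtGauge D h) {t : ℝ} (ht : 0 ≤ t) (z : Fin n → ℂ) :
    h (t • z) = t * h z := by
  have := H.smul (t : ℂ) z
  rwa [Complex.norm_of_nonneg ht, Complex.coe_smul] at this

theorem closure_eq (H : IsReinhardtGauge D h) : closure D = {z | h z ≤ 1} := by
  apply Subset.antisymm
  · refine closure_minimal (fun z hz => ((H.lt_one_iff z).2 hz).le)
      (isClosed_le H.continuous continuous_const)
  · intro z hz
    have ht : Tendsto (fun b : ℝ => b • z) (𝓝[<] 1) (𝓝 ((1 : ℝ) • z)) :=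
      ((continuous_id.smul continuous_const).tendsto 1).mono_left nhdsWithin_le_nhds
    rw [one_smul] at ht
    refine mem_closure_of_tendsto ht ?_
    filter_upwards [Ioo_mem_nhdsLT (zero_lt_one' ℝ)] with b hb
    rw [← H.lt_one_iff, H.real_smul hb.1.le]
    have h1 : h z ≤ 1 := hz
    nlinarith [hb.1, hb.2]

theorem isCompact_le (H : IsReinhardtGauge D h) (hbdd : Bornology.IsBounded D) :
    IsCompact {z | h z ≤ 1} := by
  rw [← H.closure_eq]
  exact hbdd.isCompact_closure

end IsReinhardtGauge

/-- The Minkowski functional is approximated by a finite maximum of roots of norms of monomials. -/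
theorem IsReinhardtGauge.exists_monomialNorm_family {n : ℕ} {D : Set (Fin n → ℂ)}
    {h : (Fin n → ℂ) → ℝ} (H : IsReinhardtGauge D h) (hbdd : Bornology.IsBounded D)
    (hpc : IsPolynomiallyConvex D) {κ : ℝ} (hκ : 1 < κ) :
    ∃ (N q : ℕ) (c : Fin N → ℝ) (A : Fin N → Fin n → ℕ), 0 < q ∧ (∀ j, 0 < c j) ∧
      (∀ j, ∑ k, A j k = q) ∧ (∀ w, w ≠ 0 → ∃ j, h w ^ q < monomialNorm (c j) (A j) w) ∧
      ∀ j w, monomialNorm (c j) (A j) w ≤ (κ * h w) ^ q := by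
  have hκ0 : 0 < κ := by linarith
  -- A monomial bounded by 1 on this compact shrinking of D is bounded by (κ h)^deg everywhere, by
  -- homogeneity.
  set K : Set (Fin n → ℂ) := {z | h z ≤ κ⁻¹} with hKdef
  have hκ1 : κ⁻¹ < 1 := inv_lt_one_of_one_lt₀ hκ
  have hKD : K ⊆ D := fun z hz => (H.lt_one_iff z).1 (lt_of_le_of_lt hz hκ1)
  have hKc : IsCompact K := (H.isCompact_le hbdd).of_isClosed_subset
    (isClosed_le H.continuous continuous_const) fun z hz => le_trans hz hκ1.le
  have hKR : IsReinhardt K := fun z hz w hw => (H.mono z w fun k => (hw k).le).trans hz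
  have h0K : (0 : Fin n → ℂ) ∈ K := by
    change h 0 ≤ κ⁻¹
    rw [H.map_zero]
    positivity
  have hone : ∀ z, h z = 1 → ∃ (c : ℝ) (A : Fin n → ℕ), 0 < c ∧ 0 < ∑ k, A k ∧
      (∀ w, monomialNorm c A w ≤ (κ * h w) ^ (∑ k, A k)) ∧ 1 < monomialNorm c A z := by
    intro z hz
    obtain ⟨c, A, hc, h1, h2⟩ := hpc.exists_monomialNorm hKD hKc hKR ⟨0, h0K⟩ (w := z)
      (fun hzD => absurd ((H.lt_one_iff z).2 hzD) (by simp [hz]))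
    -- A constant cannot separate z from 0 ∈ K.
    have hd : 0 < ∑ k, A k := by
      rw [Nat.pos_iff_ne_zero]
      intro h0
      have hA : ∀ k, A k = 0 := fun k => (Finset.sum_eq_zero_iff.1 h0) k (Finset.mem_univ k)
      have h3 := h1 0 h0K
      simp only [monomialNorm, hA, pow_zero, Finset.prod_const_one] at h3 h2
      linarith
    refine ⟨c, A, hc, hd, fun w => ?_, h2⟩
    rcases eq_or_ne w 0 with rfl | hw
    · have : monomialNorm c A (0 : Fin n → ℂ) = 0 := by
        have := monomialNorm_smul c A 0 le_rfl (0 : Fin n → ℂ)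
        rwa [zero_smul, zero_pow hd.ne', zero_mul] at this
      rw [this, H.map_zero, mul_zero, zero_pow hd.ne']
    · have hhw := H.pos w hw
      have hs : 0 < κ * h w := by positivity
      have hmem : (κ * h w)⁻¹ • w ∈ K := by
        change h _ ≤ κ⁻¹
        rw [H.real_smul (inv_nonneg.2 hs.le), mul_inv, mul_assoc, inv_mul_cancel₀ hhw.ne', mul_one]
      have h3 := h1 _ hmem
      rwa [monomialNorm_smul _ _ _ (inv_nonneg.2 hs.le), inv_pow, inv_mul_le_iff₀ (by positivity),
        mul_one] at h3
  choose! c A hc hd hle hgt using hone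
  have hScomp : IsCompact {z | h z = 1} := (H.isCompact_le hbdd).of_isClosed_subset
    (isClosed_eq H.continuous continuous_const) fun z hz => le_of_eq hz
  obtain ⟨t, ht, hcover⟩ := hScomp.elim_nhds_subcover
    (fun z => {w | 1 < monomialNorm (c z) (A z) w})
    (fun z hz => (isOpen_lt continuous_const (continuous_monomialNorm _ _)).mem_nhds (hgt z hz))
  set d : (Fin n → ℂ) → ℕ := fun z => ∑ k, A z k with hddef
  -- A common multiple of the degrees: raising each monomial to the power q / d z equalizes them.
  set q := ∏ z ∈ t, d z with hq
  have hq0 : 0 < q := Finset.prod_pos fun z hz => hd z (ht z hz)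
  have hdvd : ∀ z ∈ t, ∃ e, q = e * d z := fun z hz => by
    obtain ⟨e, he⟩ := Finset.dvd_prod_of_mem d hz
    exact ⟨e, he.trans (mul_comm _ _)⟩
  choose! e he using hdvd
  have he0 : ∀ z ∈ t, e z ≠ 0 := by
    intro z hz h0
    have := he z hz
    rw [h0, zero_mul] at this
    exact hq0.ne' this
  set x : Fin t.card → (Fin n → ℂ) := fun j => (t.equivFin.symm j : Fin n → ℂ)
  have hx : ∀ j, x j ∈ t := fun j => (t.equivFin.symm j).2
  refine ⟨t.card, q, fun j => c (x j) ^ e (x j), fun j k => e (x j) * A (x j) k, hq0,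
    fun j => pow_pos (hc _ (ht _ (hx j))) _, fun j => ?_, fun w hw => ?_, fun j w => ?_⟩
  · rw [← Finset.mul_sum]
    exact (he _ (hx j)).symm
  · have hhw := H.pos w hw
    have hmem : (h w)⁻¹ • w ∈ {z | h z = 1} := by
      change h _ = 1
      rw [H.real_smul (inv_nonneg.2 hhw.le), inv_mul_cancel₀ hhw.ne']
    obtain ⟨z, hzt, hz⟩ := mem_iUnion₂.1 (hcover hmem)
    refine ⟨t.equivFin ⟨z, hzt⟩, ?_⟩
    simp only [x, Equiv.symm_apply_apply]
    rw [← monomialNorm_pow, he z hzt, mul_comm (e z), pow_mul]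
    refine pow_lt_pow_left₀ ?_ (by positivity) (he0 z hzt)
    have h3 : 1 < monomialNorm (c z) (A z) ((h w)⁻¹ • w) := hz
    rw [monomialNorm_smul _ _ _ (inv_nonneg.2 hhw.le), inv_pow, lt_inv_mul_iff₀ (by positivity),
      mul_one] at h3
    exact h3
  · rw [← monomialNorm_pow, he _ (hx j), mul_comm (e (x j)), pow_mul]
    exact pow_le_pow_left₀ (monomialNorm_nonneg (hc _ (ht _ (hx j))).le _ _)
      (hle _ (ht _ (hx j)) w) _

/-! ### From N monomials to n polynomials. -/

theorem log_monomialNorm {n : ℕ} {c : ℝ} (hc : 0 < c) {A : Fin n → ℕ} {z : Fin n → ℂ}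
    (h : monomialNorm c A z ≠ 0) :
    Real.log (monomialNorm c A z) = Real.log c + ∑ k, (A k : ℝ) * Real.log ‖z k‖ := by
  unfold monomialNorm at h ⊢
  have h1 := right_ne_zero_of_mul h
  rw [Real.log_mul hc.ne' h1, Real.log_prod (fun k hk => Finset.prod_ne_zero_iff.1 h1 k hk)]
  simp only [Real.log_pow]

/-- After a generic perturbation of the coefficients, no `n + 1` monomials of the same degree
have a common nonzero absolute value at some point. -/
theorem exists_perturbation {n N : ℕ} (c : Fin N → ℝ) (hc : ∀ j, 0 < c j)
    (A : Fin N → Fin n → ℕ) {q : ℕ} (hq : 0 < q) (hA : ∀ j, ∑ k, A j k = q) {r : ℝ}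
    (hr : 1 < r) :
    ∃ c' : Fin N → ℝ, (∀ j, c j ≤ c' j ∧ c' j ≤ r * c j) ∧
      ∀ S : Finset (Fin N), S.card = n + 1 → ∀ (z : Fin n → ℂ) (τ : ℝ), τ ≠ 0 →
        ¬ ∀ j ∈ S, monomialNorm (c' j) (A j) z = τ := by
  have hrel : ∀ S : Finset (Fin N), S.card = n + 1 → ∃ l : Fin N → ℝ,
      (∀ k, ∑ j ∈ S, l j * (A j k : ℝ) = 0) ∧ ∃ j ∈ S, l j ≠ 0 := by
    intro S hS
    have hnot : ¬ LinearIndependent ℝ (fun j : S => fun k => (A j k : ℝ)) := by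
      intro hli
      have := hli.fintype_card_le_finrank
      simp only [Fintype.card_coe, Module.finrank_fin_fun, hS] at this
      omega
    obtain ⟨g, hg, i, hi⟩ := Fintype.not_linearIndependent_iff.1 hnot
    refine ⟨fun j => if hj : j ∈ S then g ⟨j, hj⟩ else 0, fun k => ?_, i, i.2, by simpa using hi⟩
    have := congrFun hg k
    simp only [Finset.sum_apply, Pi.smul_apply, smul_eq_mul, Pi.zero_apply] at this
    rw [← Finset.sum_coe_sort S, ← this]
    refine Finset.sum_congr rfl fun j _ => ?_
    simp
  choose! l hl hl0 using hrel
  -- Q S at ε is the obstruction to equal moduli on S for the coefficients c_j exp(ε^(j+1)).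
  -- Distinct exponents prevent cancellation, and starting them at 1 keeps ε^(j+1) ≤ ε and apart
  -- from the constant term.
  set Q : Finset (Fin N) → Polynomial ℝ := fun S =>
    ∑ j ∈ S, Polynomial.C (l S j) * (Polynomial.C (Real.log (c j)) + Polynomial.X ^ ((j : ℕ) + 1))
    with hQ
  have hQ0 : ∀ S : Finset (Fin N), S.card = n + 1 → Q S ≠ 0 := by
    intro S hS h0
    obtain ⟨j, hj, hlj⟩ := hl0 S hS
    have h1 : (Q S).coeff ((j : ℕ) + 1) = l S j := by
      simp only [hQ, Polynomial.finsetSum_coeff, Polynomial.coeff_C_mul, Polynomial.coeff_add,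
        Polynomial.coeff_C_succ, zero_add, Polynomial.coeff_X_pow, add_left_inj]
      rw [Finset.sum_eq_single j]
      · simp
      · intro i _ hij
        rw [if_neg (fun h => hij (Fin.ext h.symm)), mul_zero]
      · exact fun h => absurd hj h
    rw [h0, Polynomial.coeff_zero] at h1
    exact hlj h1.symm
  have hfin : (⋃ S ∈ {S : Finset (Fin N) | S.card = n + 1}, {x | (Q S).eval x = 0}).Finite := by
    refine (Set.toFinite _).biUnion fun S hS => ?_
    exact Polynomial.finite_setOfPred_isRoot (hQ0 S hS)
  have hδ : 0 < min 1 (Real.log r) := lt_min one_pos (Real.log_pos hr)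
  obtain ⟨ε, hε, hεQ⟩ := ((Ioo_infinite hδ).sdiff hfin).nonempty
  have hε1 : ε < 1 := hε.2.trans_le (min_le_left _ _)
  have hεr : ε < Real.log r := hε.2.trans_le (min_le_right _ _)
  refine ⟨fun j => c j * Real.exp (ε ^ ((j : ℕ) + 1)), fun j => ⟨?_, ?_⟩, ?_⟩
  · exact le_mul_of_one_le_right (hc j).le (Real.one_le_exp (pow_nonneg hε.1.le _))
  · rw [mul_comm r]
    refine mul_le_mul_of_nonneg_left ?_ (hc j).le
    rw [← Real.le_log_iff_exp_le (by linarith)]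
    refine le_trans ?_ hεr.le
    simpa using pow_le_pow_of_le_one hε.1.le hε1.le (Nat.le_add_left 1 (j : ℕ))
  · intro S hS z τ hτ hall
    apply hεQ
    refine mem_iUnion₂.2 ⟨S, hS, ?_⟩
    change (Q S).eval ε = 0
    have hlog : ∀ j ∈ S, Real.log (c j) + ε ^ ((j : ℕ) + 1) =
        Real.log τ - ∑ k, (A j k : ℝ) * Real.log ‖z k‖ := by
      intro j hj
      have h1 := hall j hj
      rw [← h1, log_monomialNorm (mul_pos (hc j) (Real.exp_pos _)) (h1 ▸ hτ),
        Real.log_mul (hc j).ne' (Real.exp_pos _).ne', Real.log_exp]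
      ring
    -- Equality of the degrees enters here: it removes log τ from the relation.
    have hsum : ∑ j ∈ S, l S j = 0 := by
      have h1 : ∑ j ∈ S, l S j * (q : ℝ) = 0 := by
        have h2 : ∀ j ∈ S, l S j * (q : ℝ) = ∑ k, l S j * (A j k : ℝ) := by
          intro j _
          rw [← Finset.mul_sum, ← hA j]
          push_cast
          rfl
        rw [Finset.sum_congr rfl h2, Finset.sum_comm]
        exact Finset.sum_eq_zero fun k _ => hl S hS k
      rw [← Finset.sum_mul] at h1
      exact (mul_eq_zero.1 h1).resolve_right (Nat.cast_ne_zero.2 hq.ne')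
    have heval : (Q S).eval ε = ∑ j ∈ S, l S j * (Real.log (c j) + ε ^ ((j : ℕ) + 1)) := by
      simp [hQ, Polynomial.eval_finsetSum]
    rw [heval, Finset.sum_congr rfl fun j hj => by rw [hlog j hj]]
    simp only [mul_sub, Finset.sum_sub_distrib, ← Finset.sum_mul, hsum, zero_mul, zero_sub,
      neg_eq_zero, Finset.mul_sum]
    rw [Finset.sum_comm]
    refine Finset.sum_eq_zero fun k _ => ?_
    simp only [← mul_assoc]
    rw [← Finset.sum_mul, hl S hS k, zero_mul]

/-- For monomials in general position, among any `n + 1` of them there is one that is uniformly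
smaller than the maximum. -/
theorem exists_ratio_of_general_position {n N : ℕ} (c : Fin N → ℝ) (hc : ∀ j, 0 < c j)
    (A : Fin N → Fin n → ℕ) {q : ℕ} (hA : ∀ j, ∑ k, A j k = q)
    (hpos : ∀ z : Fin n → ℂ, z ≠ 0 → ∃ j, 0 < monomialNorm (c j) (A j) z)
    (hgen : ∀ S : Finset (Fin N), S.card = n + 1 → ∀ (z : Fin n → ℂ) (τ : ℝ), τ ≠ 0 →
        ¬ ∀ j ∈ S, monomialNorm (c j) (A j) z = τ) :
    ∃ ρ : ℝ, 0 ≤ ρ ∧ ρ < 1 ∧ ∀ S : Finset (Fin N), S.card = n + 1 → ∀ z : Fin n → ℂ, z ≠ 0 →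
      ∃ j ∈ S, ∃ i, monomialNorm (c j) (A j) z ≤ ρ * monomialNorm (c i) (A i) z := by
  have hnn : ∀ j z, 0 ≤ monomialNorm (c j) (A j) z := fun j z => monomialNorm_nonneg (hc j).le _ _
  have hsphere : ∀ S : Finset (Fin N), ∃ ρ : ℝ, ρ < 1 ∧ (S.card = n + 1 →
      ∀ z ∈ Metric.sphere (0 : Fin n → ℂ) 1,
      ∃ j ∈ S, ∃ i, monomialNorm (c j) (A j) z ≤ ρ * monomialNorm (c i) (A i) z) := by
    intro S
    by_cases hS : S.card = n + 1
    swap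
    · exact ⟨0, one_pos, fun h => absurd h hS⟩
    suffices hs : ∃ ρ : ℝ, ρ < 1 ∧ ∀ z ∈ Metric.sphere (0 : Fin n → ℂ) 1,
        ∃ j ∈ S, ∃ i, monomialNorm (c j) (A j) z ≤ ρ * monomialNorm (c i) (A i) z by
      obtain ⟨ρ, h1, h2⟩ := hs
      exact ⟨ρ, h1, fun _ => h2⟩
    refine (isCompact_sphere (0 : Fin n → ℂ) 1).induction_on
      (p := fun s => ∃ ρ : ℝ, ρ < 1 ∧ ∀ z ∈ s,
        ∃ j ∈ S, ∃ i, monomialNorm (c j) (A j) z ≤ ρ * monomialNorm (c i) (A i) z) ?_ ?_ ?_ ?_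
    · exact ⟨0, one_pos, fun z hz => absurd hz (notMem_empty z)⟩
    · rintro s t hst ⟨ρ, h1, h2⟩
      exact ⟨ρ, h1, fun z hz => h2 z (hst hz)⟩
    · rintro s t ⟨ρ, h1, h2⟩ ⟨ρ', h1', h2'⟩
      refine ⟨max ρ ρ', max_lt h1 h1', ?_⟩
      rintro z (hz | hz)
      · obtain ⟨j, hj, i, hi⟩ := h2 z hz
        exact ⟨j, hj, i, hi.trans (mul_le_mul_of_nonneg_right (le_max_left _ _) (hnn _ _))⟩
      · obtain ⟨j, hj, i, hi⟩ := h2' z hz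
        exact ⟨j, hj, i, hi.trans (mul_le_mul_of_nonneg_right (le_max_right _ _) (hnn _ _))⟩
    · intro z hz
      have hz0 : z ≠ 0 := by
        rintro rfl
        simp at hz
      obtain ⟨j, hj, i, hij⟩ : ∃ j ∈ S, ∃ i,
          monomialNorm (c j) (A j) z < monomialNorm (c i) (A i) z := by
        -- Otherwise every monomial in S attains the overall maximum, which is nonzero.
        by_contra! hcon
        obtain ⟨j₁, hj₁⟩ := hpos z hz0
        obtain ⟨j₀, hj₀⟩ : S.Nonempty := Finset.card_pos.1 (by omega)
        exact hgen S hS z (monomialNorm (c j₀) (A j₀) z) (hj₁.trans_le (hcon j₀ hj₀ j₁)).ne'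
          fun j hj => le_antisymm (hcon j₀ hj₀ j) (hcon j hj j₀)
      have hi0 := (hnn j z).trans_lt hij
      obtain ⟨ρ, h1, h2⟩ := exists_between ((div_lt_one hi0).2 hij)
      rw [div_lt_iff₀ hi0] at h1
      refine ⟨{w | monomialNorm (c j) (A j) w < ρ * monomialNorm (c i) (A i) w},
        mem_nhdsWithin_of_mem_nhds ((isOpen_lt (continuous_monomialNorm _ _)
          (continuous_const.mul (continuous_monomialNorm _ _))).mem_nhds h1), ρ, h2, ?_⟩
      exact fun w hw => ⟨j, hj, i, le_of_lt hw⟩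
  choose ρ hρ1 hρ using hsphere
  obtain ⟨S₀, hS₀⟩ := Finite.exists_max ρ
  refine ⟨max 0 (ρ S₀), le_max_left _ _, max_lt one_pos (hρ1 S₀), fun S hS z hz => ?_⟩
  have hz' : 0 < ‖z‖ := norm_pos_iff.2 hz
  obtain ⟨j, hj, i, hi⟩ := hρ S hS (‖z‖⁻¹ • z) (by simp [norm_smul, hz'.ne'])
  refine ⟨j, hj, i, ?_⟩
  rw [monomialNorm_smul _ _ _ (by positivity), monomialNorm_smul _ _ _ (by positivity), hA, hA,
    mul_left_comm] at hi
  refine (le_of_mul_le_mul_left hi (by positivity)).trans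
    (mul_le_mul_of_nonneg_right ((hS₀ S).trans (le_max_right _ _)) (hnn _ _))

/-- If at most `n` of the numbers `y j` are comparable to their maximum `μ`, then one of the `n`
first Vandermonde combinations of their high powers is comparable to the power of `μ`. -/
theorem exists_vandermonde_bound {n : ℕ} (hn : 0 < n) (N : ℕ) {ρ : ℝ} (hρ0 : 0 ≤ ρ) (hρ1 : ρ < 1) :
    ∃ (B : ℝ) (m₀ : ℕ), 0 < B ∧ ∀ m, m₀ ≤ m → ∀ (y : Fin N → ℂ) (μ : ℝ), 0 < μ →
      (∀ j, ‖y j‖ ≤ μ) → (∃ j, ‖y j‖ = μ) →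
      (∀ S : Finset (Fin N), S.card = n + 1 → ∃ j ∈ S, ‖y j‖ ≤ ρ * μ) →
      ∃ k : Fin n, μ ^ m ≤ B * ‖∑ j : Fin N, ((j : ℕ) : ℂ) ^ (k : ℕ) * y j ^ m‖ := by
  set x : Fin N → ℂ := fun j => ((j : ℕ) : ℂ) with hx
  have hxinj : Function.Injective x := fun a b hab => Fin.ext (Nat.cast_injective hab)
  -- Only finitely many interpolation polynomials occur, so the bounds E and L for their
  -- coefficients and values do not depend on y.
  set b : Finset (Fin N) × Fin N → Polynomial ℂ := fun s => Lagrange.basis s.1 x s.2 with hb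
  obtain ⟨E, hE⟩ := Finite.bddAbove_range fun s => ∑ k : Fin n, ‖(b s).coeff k‖
  obtain ⟨L, hL⟩ := Finite.bddAbove_range fun s : (Finset (Fin N) × Fin N) × Fin N =>
    ‖(b s.1).eval (x s.2)‖
  have hE' : ∀ s, ∑ k : Fin n, ‖(b s).coeff k‖ ≤ max E 0 + 1 := fun s =>
    (hE ⟨s, rfl⟩).trans (by linarith [le_max_left E 0])
  have hL' : ∀ s j, ‖(b s).eval (x j)‖ ≤ max L 0 := fun s j =>
    (hL ⟨(s, j), rfl⟩).trans (le_max_left _ _)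
  have hE0 : 0 < max E 0 + 1 := by positivity
  have hlim : Tendsto (fun m : ℕ => (N * max L 0) * ρ ^ m) atTop (𝓝 ((N * max L 0) * 0)) :=
    (tendsto_pow_atTop_nhds_zero_of_lt_one hρ0 hρ1).const_mul _
  rw [mul_zero] at hlim
  obtain ⟨m₀, hm₀⟩ := eventually_atTop.1 (hlim.eventually (gt_mem_nhds (half_pos one_pos)))
  refine ⟨2 * (max E 0 + 1), m₀, by positivity, ?_⟩
  rintro m hm y μ hμ hle ⟨j₀, hj₀⟩ hS
  -- Interpolation on J kills all its terms but j₀; the terms outside J total at most N L (ρμ)^m,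
  -- less than half of μ^m by the choice of m₀.
  set J : Finset (Fin N) := Finset.univ.filter fun j => ρ * μ < ‖y j‖ with hJ
  have hJcard : J.card ≤ n := by
    by_contra! hcon
    obtain ⟨S, hSJ, hScard⟩ := Finset.exists_subset_card_eq (Nat.succ_le_of_lt hcon)
    obtain ⟨j, hj, hjle⟩ := hS S hScard
    exact absurd (Finset.mem_filter.1 (hSJ hj)).2 (not_lt.2 hjle)
  have hj₀J : j₀ ∈ J := Finset.mem_filter.2 ⟨Finset.mem_univ _, by rw [hj₀]; nlinarith⟩
  set p := b (J, j₀) with hp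
  have hdeg : p.natDegree < n := by
    have h1 : p.natDegree ≤ J.card - 1 := by
      refine Polynomial.natDegree_le_of_degree_le ?_
      rw [hp, hb]
      exact (Lagrange.degree_basis hxinj.injOn hj₀J).le
    have : 0 < J.card := Finset.card_pos.2 ⟨_, hj₀J⟩
    omega
  have hid : ∑ k : Fin n, p.coeff k * ∑ j, x j ^ (k : ℕ) * y j ^ m
      = ∑ j, p.eval (x j) * y j ^ m := by
    simp only [Finset.mul_sum]
    rw [Finset.sum_comm]
    refine Finset.sum_congr rfl fun j _ => ?_
    rw [Polynomial.eval_eq_sum_range' hdeg, Finset.sum_mul,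
      ← Fin.sum_univ_eq_sum_range (fun i => p.coeff i * x j ^ i * y j ^ m) n]
    exact Finset.sum_congr rfl fun k _ => by ring
  have hlow : μ ^ m / 2 ≤ ‖∑ j, p.eval (x j) * y j ^ m‖ := by
    rw [← Finset.add_sum_erase _ _ (Finset.mem_univ j₀)]
    have h1 : p.eval (x j₀) = 1 := Lagrange.eval_basis_self hxinj.injOn hj₀J
    have h2 : ‖∑ j ∈ Finset.univ.erase j₀, p.eval (x j) * y j ^ m‖
        ≤ N * (max L 0 * (ρ * μ) ^ m) := by
      refine (norm_sum_le _ _).trans ((Finset.sum_le_card_nsmul _ _ (max L 0 * (ρ * μ) ^ m)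
        fun j hj => ?_).trans ?_)
      · by_cases hjJ : j ∈ J
        · rw [hp, hb, Lagrange.eval_basis_of_ne (Finset.ne_of_mem_erase hj).symm hjJ, zero_mul,
            norm_zero]
          positivity
        · rw [norm_mul, norm_pow]
          have h3 : ‖y j‖ ≤ ρ * μ := by
            by_contra! hcon
            exact hjJ (Finset.mem_filter.2 ⟨Finset.mem_univ _, hcon⟩)
          gcongr
          exact hL' _ _
      · rw [nsmul_eq_mul]
        gcongr
        exact_mod_cast (Finset.card_le_univ _).trans (by simp)
    have h4 : N * (max L 0 * (ρ * μ) ^ m) ≤ μ ^ m / 2 := by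
      have h5 := hm₀ m hm
      have h6 : 0 < μ ^ m := by positivity
      rw [mul_pow]
      nlinarith
    have h7 := norm_sub_norm_le (p.eval (x j₀) * y j₀ ^ m)
      (-∑ j ∈ Finset.univ.erase j₀, p.eval (x j) * y j ^ m)
    rw [sub_neg_eq_add, norm_neg, h1, one_mul, norm_pow, hj₀] at h7
    rw [h1, one_mul]
    linarith
  have : Nonempty (Fin n) := ⟨⟨0, hn⟩⟩
  obtain ⟨k, hk⟩ := Finite.exists_max fun k : Fin n => ‖∑ j, x j ^ (k : ℕ) * y j ^ m‖
  refine ⟨k, ?_⟩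
  have hup : ‖∑ j, p.eval (x j) * y j ^ m‖
      ≤ (max E 0 + 1) * ‖∑ j, x j ^ (k : ℕ) * y j ^ m‖ := by
    rw [← hid]
    refine (norm_sum_le _ _).trans ?_
    refine le_trans (Finset.sum_le_sum fun i _ => ?_)
      ((Finset.sum_mul _ _ _).ge.trans (mul_le_mul_of_nonneg_right (hE' (J, j₀)) (norm_nonneg _)))
    rw [norm_mul]
    exact mul_le_mul_of_nonneg_left (hk i) (norm_nonneg _)
  rw [mul_assoc]
  linarith

/-- The Minkowski functional is approximated by the maximum of the roots of the absolute values of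
`n` homogeneous polynomials. -/
theorem IsReinhardtGauge.exists_polynomials {n : ℕ} (hn : 0 < n) {D : Set (Fin n → ℂ)}
    {h : (Fin n → ℂ) → ℝ} (H : IsReinhardtGauge D h) (hbdd : Bornology.IsBounded D)
    (hpc : IsPolynomiallyConvex D) {κ : ℝ} (hκ : 1 < κ) :
    ∃ (q : ℕ) (P : Fin n → MvPolynomial (Fin n) ℂ), 0 < q ∧ (∀ k, (P k).IsHomogeneous q) ∧
      ∀ z, (∃ k, (κ⁻¹ * h z) ^ q ≤ ‖MvPolynomial.eval z (P k)‖) ∧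
        ∀ k, ‖MvPolynomial.eval z (P k)‖ ≤ (κ ^ 3 * h z) ^ q := by
  have hκ0 : 0 < κ := by linarith
  obtain ⟨N, q, c₀, A, hq, hc₀, hA, hlow₀, hup₀⟩ := H.exists_monomialNorm_family hbdd hpc hκ
  -- The ratio κ^q costs one factor κ after the q-th root.
  obtain ⟨c, hcc, hgen⟩ := exists_perturbation c₀ hc₀ A hq hA (one_lt_pow₀ hκ hq.ne')
  have hc : ∀ j, 0 < c j := fun j => (hc₀ j).trans_le (hcc j).1
  have hlow : ∀ w, w ≠ 0 → ∃ j, h w ^ q < monomialNorm (c j) (A j) w := by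
    intro w hw
    obtain ⟨j, hj⟩ := hlow₀ w hw
    refine ⟨j, hj.trans_le ?_⟩
    exact mul_le_mul_of_nonneg_right (hcc j).1 (by positivity)
  have hup : ∀ j w, monomialNorm (c j) (A j) w ≤ (κ ^ 2 * h w) ^ q := by
    intro j w
    calc monomialNorm (c j) (A j) w ≤ κ ^ q * monomialNorm (c₀ j) (A j) w := by
          unfold monomialNorm
          rw [← mul_assoc]
          exact mul_le_mul_of_nonneg_right (hcc j).2 (by positivity)
      _ ≤ κ ^ q * (κ * h w) ^ q := by gcongr; exact hup₀ j w
      _ = _ := by rw [← mul_pow]; ring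
  obtain ⟨ρ, hρ0, hρ1, hρ⟩ := exists_ratio_of_general_position c hc A hA
    (fun z hz => (hlow z hz).imp fun j hj => (pow_nonneg (H.nonneg z) q).trans_lt hj) hgen
  obtain ⟨B, m₀, hB, hvan⟩ := exists_vandermonde_bound hn N hρ0 hρ1
  -- m is so large that κ^(qm) absorbs both B and N · N^n. The final κ³ is one factor each for the
  -- approximation, the perturbation and this absorption.
  obtain ⟨m, hm0, hm1, hmB, hmN⟩ : ∃ m, m₀ ≤ m ∧ 1 ≤ m ∧ B ≤ (κ ^ q) ^ m ∧
      (N : ℝ) * N ^ n ≤ (κ ^ q) ^ m := by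
    have ht := tendsto_pow_atTop_atTop_of_one_lt (one_lt_pow₀ hκ hq.ne')
    obtain ⟨m, h1, h2, h3, h4⟩ := ((eventually_ge_atTop m₀).and ((eventually_ge_atTop 1).and
      ((ht.eventually_ge_atTop B).and (ht.eventually_ge_atTop ((N : ℝ) * N ^ n))))).exists
    exact ⟨m, h1, h2, h3, h4⟩
  set y : (Fin n → ℂ) → Fin N → ℂ := fun z j => (c j : ℂ) * ∏ k, z k ^ A j k with hy
  have hynorm : ∀ z j, ‖y z j‖ = monomialNorm (c j) (A j) z := by
    intro z j
    simp only [hy, norm_mul, norm_prod, norm_pow, monomialNorm,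
      Complex.norm_of_nonneg (hc j).le]
  set P : Fin n → MvPolynomial (Fin n) ℂ := fun k => ∑ j : Fin N,
    MvPolynomial.C (((j : ℕ) : ℂ) ^ (k : ℕ)) *
      (MvPolynomial.C (c j : ℂ) * ∏ i, MvPolynomial.X i ^ A j i) ^ m with hP
  have heval : ∀ z k, MvPolynomial.eval z (P k)
      = ∑ j : Fin N, ((j : ℕ) : ℂ) ^ (k : ℕ) * y z j ^ m := by
    intro z k
    simp [hP, hy]
  refine ⟨q * m, P, Nat.mul_pos hq hm1, fun k => ?_, fun z => ⟨?_, fun k => ?_⟩⟩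
  · refine MvPolynomial.IsHomogeneous.sum _ _ _ fun j _ => ?_
    refine MvPolynomial.IsHomogeneous.C_mul (MvPolynomial.IsHomogeneous.pow
      (MvPolynomial.IsHomogeneous.C_mul ?_ _) m) _
    rw [← hA j]
    exact MvPolynomial.IsHomogeneous.prod _ _ _ fun i _ => by
      simpa using (MvPolynomial.isHomogeneous_X ℂ i).pow (A j i)
  · rcases eq_or_ne z 0 with rfl | hz
    · refine ⟨⟨0, hn⟩, ?_⟩
      rw [H.map_zero, mul_zero, zero_pow (Nat.mul_pos hq hm1).ne']
      exact norm_nonneg _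
    · obtain ⟨j₁, hj₁⟩ := hlow z hz
      have : Nonempty (Fin N) := ⟨j₁⟩
      obtain ⟨j₀, hj₀⟩ := Finite.exists_max fun j => ‖y z j‖
      have hμ : h z ^ q ≤ ‖y z j₀‖ := hj₁.le.trans ((hynorm z j₁).symm.le.trans (hj₀ j₁))
      have hhz := H.pos z hz
      obtain ⟨k, hk⟩ := hvan m hm0 (y z) ‖y z j₀‖ ((pow_pos hhz q).trans_le hμ) hj₀ ⟨j₀, rfl⟩
        (fun S hS => by
          obtain ⟨j, hj, i, hi⟩ := hρ S hS z hz
          refine ⟨j, hj, ?_⟩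
          rw [← hynorm, ← hynorm] at hi
          exact hi.trans (mul_le_mul_of_nonneg_left (hj₀ i) hρ0))
      refine ⟨k, ?_⟩
      rw [heval, pow_mul, mul_pow, mul_pow, inv_pow, inv_pow, inv_mul_le_iff₀ (by positivity)]
      calc (h z ^ q) ^ m ≤ ‖y z j₀‖ ^ m := by gcongr
        _ ≤ _ := hk
        _ ≤ _ := by gcongr
  · rw [heval]
    calc ‖∑ j : Fin N, ((j : ℕ) : ℂ) ^ (k : ℕ) * y z j ^ m‖
        ≤ ∑ j : Fin N, (N : ℝ) ^ n * ((κ ^ 2 * h z) ^ q) ^ m := by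
          refine (norm_sum_le _ _).trans (Finset.sum_le_sum fun j _ => ?_)
          rw [norm_mul, norm_pow, norm_pow, Complex.norm_natCast, hynorm]
          have hN1 : (1 : ℝ) ≤ N := by exact_mod_cast (Nat.zero_le _).trans_lt j.2
          have hjN : ((j : ℕ) : ℝ) ≤ N := by exact_mod_cast j.2.le
          refine mul_le_mul ?_ ?_ (pow_nonneg (monomialNorm_nonneg (hc j).le _ _) _)
            (by positivity)
          · exact (pow_le_pow_left₀ (by positivity) hjN _).trans (pow_le_pow_right₀ hN1 k.2.le)
          · exact pow_le_pow_left₀ (monomialNorm_nonneg (hc j).le _ _) (hup j z) _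
      _ = ((N : ℝ) * N ^ n) * ((κ ^ 2 * h z) ^ q) ^ m := by simp [mul_assoc]
      _ ≤ (κ ^ q) ^ m * ((κ ^ 2 * h z) ^ q) ^ m := by
          have := H.nonneg z
          gcongr
      _ = (κ ^ 3 * h z) ^ (q * m) := by rw [← mul_pow, ← mul_pow, pow_mul]; ring

/-! ### Circle means, and plurisubharmonicity of logarithms of monomials. -/

theorem coe_average_eq_sub {α : Type*} [MeasurableSpace α] {μ : Measure α} {f : α → ℝ}
    (hf : Integrable f μ) :
    ((⨍ x, f x ∂μ : ℝ) : EReal) = ((⨍⁻ x, ENNReal.ofReal (f x) ∂μ : ℝ≥0∞) : EReal) -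
      ((⨍⁻ x, ENNReal.ofReal (-f x) ∂μ : ℝ≥0∞) : EReal) := by
  have h1 := hf.to_average
  have h2 : ∀ g : α → ℝ, Integrable g ((μ univ)⁻¹ • μ) →
      ∫⁻ x, ENNReal.ofReal (g x) ∂(μ univ)⁻¹ • μ ≠ ∞ :=
    fun g hg => (hg.lintegral_lt_top).ne
  rw [average_eq', integral_eq_lintegral_pos_part_sub_lintegral_neg_part h1, EReal.coe_sub,
    EReal.coe_ennreal_toReal (h2 f h1), EReal.coe_ennreal_toReal (h2 (fun x => -f x) h1.neg)]
  rfl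

theorem circleMean_le_average {n : ℕ} {u : (Fin n → ℂ) → EReal} {a b : Fin n → ℂ} {f : ℝ → ℝ}
    (hf : IntegrableOn f (Ioc 0 (2 * Real.pi)))
    (h : ∀ θ, u (a + circleMap 0 1 θ • b) ≤ (f θ : EReal)) :
    circleMean u a b ≤ ((⨍ θ in Ioc (0 : ℝ) (2 * Real.pi), f θ : ℝ) : EReal) := by
  rw [coe_average_eq_sub hf, circleMean]
  refine EReal.sub_le_sub ?_ ?_
  · refine EReal.coe_ennreal_le_coe_ennreal_iff.2 (laverage_mono_ae (ae_of_all _ fun θ => ?_))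
    exact EReal.toENNReal_le_toENNReal (h θ)
  · refine EReal.coe_ennreal_le_coe_ennreal_iff.2 (laverage_mono_ae (ae_of_all _ fun θ => ?_))
    have := EReal.toENNReal_le_toENNReal (EReal.neg_le_neg_iff.2 (h θ))
    rwa [← EReal.coe_neg, EReal.real_coe_toENNReal] at this

/-- An almost everywhere bound is needed: the logarithm of a polynomial is -∞ at zeros on the
circle, where `Real.log` takes the value 0. -/
theorem average_le_circleMean {n : ℕ} {u : (Fin n → ℂ) → EReal} {a b : Fin n → ℂ} {f : ℝ → ℝ}
    (hf : IntegrableOn f (Ioc 0 (2 * Real.pi)))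
    (h : ∀ᵐ θ : ℝ, (f θ : EReal) ≤ u (a + circleMap 0 1 θ • b)) :
    ((⨍ θ in Ioc (0 : ℝ) (2 * Real.pi), f θ : ℝ) : EReal) ≤ circleMean u a b := by
  rw [coe_average_eq_sub hf, circleMean]
  have h' := ae_restrict_of_ae (s := Ioc (0 : ℝ) (2 * Real.pi)) h
  refine EReal.sub_le_sub ?_ ?_
  · refine EReal.coe_ennreal_le_coe_ennreal_iff.2 (laverage_mono_ae (h'.mono fun θ hθ => ?_))
    exact EReal.toENNReal_le_toENNReal hθ
  · refine EReal.coe_ennreal_le_coe_ennreal_iff.2 (laverage_mono_ae (h'.mono fun θ hθ => ?_))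
    have := EReal.toENNReal_le_toENNReal (EReal.neg_le_neg_iff.2 hθ)
    rwa [← EReal.coe_neg, EReal.real_coe_toENNReal] at this

theorem circleAverage_eq_setAverage (f : ℂ → ℝ) (c : ℂ) (R : ℝ) :
    Real.circleAverage f c R = ⨍ θ in Ioc (0 : ℝ) (2 * Real.pi), f (circleMap c R θ) := by
  rw [Real.circleAverage_eq_intervalAverage, uIoc_of_le Real.two_pi_pos.le]

/-- Jensen's inequality, read off from the bound of the constant coefficient by the Mahler measure.
-/
theorem log_norm_coeff_zero_le_circleAverage {p : Polynomial ℂ} (hp : p.coeff 0 ≠ 0) :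
    Real.log ‖p.coeff 0‖ ≤ Real.circleAverage (fun x => Real.log ‖p.eval x‖) 0 1 := by
  have h := Polynomial.norm_coeff_le_choose_mul_mahlerMeasure 0 p
  rw [Nat.choose_zero_right, Nat.cast_one, one_mul] at h
  rw [← Polynomial.logMahlerMeasure_def, Polynomial.logMahlerMeasure_eq_log_MahlerMeasure]
  exact Real.log_le_log (norm_pos_iff.2 hp) h

/-- The logarithm of a root of the norm of a monomial. -/
noncomputable def logMonomial {n : ℕ} (s c : ℝ) (A : Fin n → ℕ) (z : Fin n → ℂ) : EReal :=
  ENNReal.log (ENNReal.ofReal (monomialNorm c A z ^ s))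

theorem logMonomial_eq {n : ℕ} {s c : ℝ} {A : Fin n → ℕ} {z : Fin n → ℂ}
    (h : 0 < monomialNorm c A z) :
    logMonomial s c A z = ((s * Real.log (monomialNorm c A z) : ℝ) : EReal) := by
  rw [logMonomial, ENNReal.log_ofReal_of_pos (Real.rpow_pos_of_pos h s), Real.log_rpow h]

theorem logMonomial_le {n : ℕ} {c r : ℝ} {q : ℕ} (hq : 0 < q) (hc : 0 < c) {A : Fin n → ℕ}
    {z : Fin n → ℂ} (hr : 0 < r) (h : monomialNorm c A z ≤ r ^ q) :
    logMonomial (q : ℝ)⁻¹ c A z ≤ (Real.log r : EReal) := by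
  rw [← ENNReal.log_ofReal_of_pos hr]
  refine ENNReal.log_monotone (ENNReal.ofReal_le_ofReal ?_)
  calc monomialNorm c A z ^ (q : ℝ)⁻¹ ≤ (r ^ q) ^ (q : ℝ)⁻¹ :=
        Real.rpow_le_rpow (monomialNorm_nonneg hc.le _ _) h (by positivity)
    _ = r := Real.pow_rpow_inv_natCast hr.le hq.ne'

theorem continuous_logMonomial {n : ℕ} {s : ℝ} (hs : 0 ≤ s) (c : ℝ) (A : Fin n → ℕ) :
    Continuous (logMonomial s c A) := by
  refine ENNReal.continuous_log.comp (ENNReal.continuous_ofReal.comp ?_)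
  exact (continuous_monomialNorm c A).rpow_const fun _ => Or.inr hs

/-- On a complex line the monomial is a one-variable polynomial p, and Jensen's inequality for p is
the sub-mean value property. -/
theorem pshOn_logMonomial {n : ℕ} {s c : ℝ} (hs : 0 < s) (hc : 0 < c) (A : Fin n → ℕ)
    (D : Set (Fin n → ℂ)) : PSHOn (logMonomial s c A) D := by
  refine ⟨fun z _ => ?_,
    (continuous_logMonomial hs.le c A).upperSemicontinuous.upperSemicontinuousOn _, ?_⟩
  · rw [logMonomial, lt_top_iff_ne_top, ne_eq, ENNReal.log_eq_top_iff]
    exact ENNReal.ofReal_ne_top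
  · intro a b _
    rcases (monomialNorm_nonneg hc.le A a).eq_or_lt' with h0 | h0
    · rw [logMonomial, h0, Real.zero_rpow hs.ne', ENNReal.ofReal_zero, ENNReal.log_zero]
      exact bot_le
    set p : Polynomial ℂ := Polynomial.C (c : ℂ) *
      ∏ k, (Polynomial.C (a k) + Polynomial.X * Polynomial.C (b k)) ^ A k with hp
    have heval : ∀ ζ, ‖p.eval ζ‖ = monomialNorm c A (a + ζ • b) := by
      intro ζ
      simp only [hp, Polynomial.eval_mul, Polynomial.eval_C, Polynomial.eval_prod,
        Polynomial.eval_pow, Polynomial.eval_add, Polynomial.eval_X, norm_mul, norm_prod, norm_pow,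
        monomialNorm, Complex.norm_of_nonneg hc.le, Pi.add_apply, Pi.smul_apply, smul_eq_mul]
    have hcoeff : ‖p.coeff 0‖ = monomialNorm c A a := by
      rw [Polynomial.coeff_zero_eq_eval_zero, heval, zero_smul, add_zero]
    have hc0 : p.coeff 0 ≠ 0 := norm_pos_iff.1 (hcoeff ▸ h0)
    have hp0 : p ≠ 0 := by
      intro h
      rw [h, Polynomial.coeff_zero] at hc0
      exact hc0 rfl
    have hae : ∀ᵐ θ : ℝ, 0 < monomialNorm c A (a + circleMap 0 1 θ • b) := by
      have hcount : (circleMap 0 1 ⁻¹' {ζ | p.eval ζ = 0}).Countable :=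
        ((Polynomial.finite_setOfPred_isRoot hp0).countable).preimage_circleMap 0 one_ne_zero
      filter_upwards [measure_eq_zero_iff_ae_notMem.1 (hcount.measure_zero volume)] with θ hθ
      rw [← heval]
      exact norm_pos_iff.2 hθ
    have hint : CircleIntegrable (fun x => s * Real.log ‖p.eval x‖) 0 1 := by
      have h1 : CircleIntegrable (fun x => Real.log ‖p.eval x‖) 0 1 :=
        ((AnalyticOnNhd.aeval_polynomial analyticOnNhd_id p).meromorphicOn).circleIntegrable_log_norm
      exact h1.const_smul (a := s)
    refine le_trans ?_ (average_le_circleMean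
      (f := fun θ => s * Real.log ‖p.eval (circleMap 0 1 θ)‖) ?_ ?_)
    · rw [← circleAverage_eq_setAverage (fun x => s * Real.log ‖p.eval x‖), logMonomial_eq h0,
        EReal.coe_le_coe_iff]
      have h2 : Real.circleAverage (fun x => s * Real.log ‖p.eval x‖) 0 1
          = s * Real.circleAverage (fun x => Real.log ‖p.eval x‖) 0 1 :=
        Real.circleAverage_fun_smul (a := s)
      rw [h2, ← hcoeff]
      exact mul_le_mul_of_nonneg_left (log_norm_coeff_zero_le_circleAverage hc0) hs.le
    · exact (intervalIntegrable_iff_integrableOn_Ioc_of_le Real.two_pi_pos.le).1 hint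
    · filter_upwards [hae] with θ hθ
      rw [logMonomial_eq hθ, heval]

/-! ### The maximum principle in complex lines. -/

open InnerProductSpace in
/-- On a disc in a complex line, a plurisubharmonic function is dominated by the harmonic
functions that dominate it on the boundary. -/
theorem PSHOn.le_harmonic {n : ℕ} {u : (Fin n → ℂ) → EReal} {D : Set (Fin n → ℂ)}
    (hu : PSHOn u D) (z : Fin n → ℂ) {c : ℂ} {ρ : ℝ} (hρ : 0 < ρ)
    (hD : ∀ ζ ∈ Metric.closedBall c ρ, ζ • z ∈ D) {φ : ℂ → ℝ}
    (hφ : HarmonicOnNhd φ (Metric.closedBall c ρ))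
    (hle : ∀ ζ ∈ Metric.sphere c ρ, u (ζ • z) ≤ (φ ζ : EReal)) : u (c • z) ≤ (φ c : EReal) := by
  have hcirc : ∀ ζ : ℂ, c • z + ζ • ((ρ : ℂ) • z) = (c + ρ * ζ) • z := by
    intro ζ
    rw [smul_smul, ← add_smul, mul_comm]
  have hmap : ∀ θ, c + ρ * circleMap 0 1 θ = circleMap c ρ θ := by
    intro θ
    simp [circleMap]
  have h1 := hu.submean (c • z) ((ρ : ℂ) • z) fun ζ hζ => by
    rw [hcirc]
    refine hD _ ?_
    rw [mem_closedBall_iff_norm, add_sub_cancel_left, norm_mul, Complex.norm_of_nonneg hρ.le]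
    exact mul_le_of_le_one_right hρ.le hζ
  have hav : Real.circleAverage φ c ρ = φ c :=
    InnerProductSpace.HarmonicOnNhd.circleAverage_eq (by rwa [abs_of_pos hρ])
  have hint : CircleIntegrable φ c ρ :=
    (hφ.continuousOn.mono Metric.sphere_subset_closedBall).circleIntegrable hρ.le
  rw [← hav, circleAverage_eq_setAverage]
  refine h1.trans (circleMean_le_average
    ((intervalIntegrable_iff_integrableOn_Ioc_of_le Real.two_pi_pos.le).1 hint) fun θ => ?_)
  rw [hcirc, hmap]
  exact hle _ (circleMap_mem_sphere c hρ.le θ)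

open InnerProductSpace in
/-- The maximum principle on an annulus in a complex line through the origin. -/
theorem PSHOn.le_on_annulus {n : ℕ} {u : (Fin n → ℂ) → EReal} {D : Set (Fin n → ℂ)}
    (hu : PSHOn u D) (z : Fin n → ℂ) {r R A B : ℝ} (hr : 0 < r)
    (hD : ∀ ζ : ℂ, r ≤ ‖ζ‖ → ‖ζ‖ ≤ R → ζ • z ∈ D)
    (hinner : ∀ ζ : ℂ, ‖ζ‖ = r → u (ζ • z) ≤ ((A + B * Real.log r : ℝ) : EReal))
    (houter : ∀ ζ : ℂ, ‖ζ‖ = R → u (ζ • z) ≤ ((A + B * Real.log R : ℝ) : EReal))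
    (ζ : ℂ) (hζr : r ≤ ‖ζ‖) (hζR : ‖ζ‖ ≤ R) :
    u (ζ • z) ≤ ((A + B * Real.log ‖ζ‖ : ℝ) : EReal) := by
  by_contra! hcon
  obtain ⟨y, hy1, hy2⟩ := EReal.lt_iff_exists_real_btwn.1 hcon
  rw [EReal.coe_lt_coe_iff] at hy1
  -- The denominator R² + 1 keeps the correction ε(R² - |w|²) in Ψ below the gap at ζ. This
  -- correction makes Ψ strictly superharmonic, so u - Ψ has no interior maximum; on the boundary u
  -- ≤ Ψ.
  set ε := (y - (A + B * Real.log ‖ζ‖)) / (R ^ 2 + 1) with hε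
  have hε0 : 0 < ε := div_pos (by linarith) (by positivity)
  set Ψ : ℂ → ℝ := fun w => A + B * Real.log ‖w‖ + ε * (R ^ 2 - ‖w‖ ^ 2) with hΨ
  have hΨζ : Ψ ζ < y := by
    have h1 : ε * (R ^ 2 + 1) = y - (A + B * Real.log ‖ζ‖) := by rw [hε]; field_simp
    have h2 := sq_nonneg ‖ζ‖
    simp only [hΨ]
    nlinarith
  set S : Set ℂ := {w | r ≤ ‖w‖ ∧ ‖w‖ ≤ R} with hS
  have hScomp : IsCompact S := by
    refine (isCompact_closedBall (0 : ℂ) R).of_isClosed_subset ?_ fun w hw => by simpa using hw.2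
    exact (isClosed_le continuous_const continuous_norm).inter
      (isClosed_le continuous_norm continuous_const)
  have hne0 : ∀ w ∈ S, w ≠ 0 := fun w hw => norm_pos_iff.1 (hr.trans_le hw.1)
  have hΨc : ContinuousOn Ψ S := by
    have hlog : ContinuousOn (fun w : ℂ => Real.log ‖w‖) S :=
      continuous_norm.continuousOn.log fun w hw => norm_ne_zero_iff.2 (hne0 w hw)
    simp only [hΨ]
    fun_prop
  have husc : UpperSemicontinuousOn (fun w : ℂ => u (w • z) + ((-Ψ w : ℝ) : EReal)) S := by
    refine UpperSemicontinuousOn.add' ?_ ?_ ?_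
    · exact hu.usc.comp (t := S) (by fun_prop) fun w hw => hD w hw.1 hw.2
    · exact (continuous_coe_real_ereal.comp_continuousOn hΨc.neg).upperSemicontinuousOn
    · exact fun w _ => EReal.continuousAt_add (Or.inr (EReal.coe_ne_bot _))
        (Or.inr (EReal.coe_ne_top _))
  have hζS : ζ ∈ S := ⟨hζr, hζR⟩
  obtain ⟨w₀, hw₀, hmax⟩ := husc.exists_isMaxOn ⟨ζ, hζS⟩ hScomp
  have hpos : ((0 : ℝ) : EReal) < u (w₀ • z) + ((-Ψ w₀ : ℝ) : EReal) := by
    refine lt_of_lt_of_le ?_ (hmax hζS)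
    have h1 : ((y + -Ψ ζ : ℝ) : EReal) ≤ u (ζ • z) + ((-Ψ ζ : ℝ) : EReal) := by
      rw [EReal.coe_add]
      exact add_le_add_left hy2.le _
    exact lt_of_lt_of_le (EReal.coe_lt_coe_iff.2 (by linarith)) h1
  obtain ⟨v, hv⟩ : ∃ v : ℝ, u (w₀ • z) = v := by
    have h1 : u (w₀ • z) ≠ ⊤ := (hu.lt_top _ (hD _ hw₀.1 hw₀.2)).ne
    have h2 : u (w₀ • z) ≠ ⊥ := by
      intro h
      rw [h, EReal.bot_add] at hpos
      exact not_lt_bot hpos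
    exact ⟨_, (EReal.coe_toReal h1 h2).symm⟩
  rw [hv, ← EReal.coe_add, EReal.coe_lt_coe_iff] at hpos
  have hle : ∀ w ∈ S, u (w • z) ≤ ((v - Ψ w₀ + Ψ w : ℝ) : EReal) := by
    intro w hw
    have h1 : u (w • z) + ((-Ψ w : ℝ) : EReal) ≤ ((v + -Ψ w₀ : ℝ) : EReal) := by
      rw [EReal.coe_add, ← hv]
      exact hmax hw
    have h2 := add_le_add_left h1 (Ψ w : EReal)
    rw [add_assoc, ← EReal.coe_add, ← EReal.coe_add] at h2
    simpa [sub_eq_add_neg] using h2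
  have hr₀ : r < ‖w₀‖ := by
    refine lt_of_le_of_ne hw₀.1 fun h => ?_
    have h1 := hinner w₀ h.symm
    rw [hv, EReal.coe_le_coe_iff] at h1
    have h2 : Ψ w₀ = A + B * Real.log r + ε * (R ^ 2 - r ^ 2) := by simp only [hΨ, ← h]
    have h3 : r ≤ R := hw₀.1.trans hw₀.2
    have h4 : 0 ≤ ε * (R ^ 2 - r ^ 2) :=
      mul_nonneg hε0.le (sub_nonneg.2 (pow_le_pow_left₀ hr.le h3 2))
    linarith
  have hR₀ : ‖w₀‖ < R := by
    refine lt_of_le_of_ne hw₀.2 fun h => ?_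
    have h1 := houter w₀ h
    rw [hv, EReal.coe_le_coe_iff] at h1
    have h2 : Ψ w₀ = A + B * Real.log R := by simp only [hΨ, h, sub_self, mul_zero, add_zero]
    linarith
  set ρ := min (‖w₀‖ - r) (R - ‖w₀‖) with hρ
  have hρ0 : 0 < ρ := lt_min (by linarith) (by linarith)
  have hball : ∀ w ∈ Metric.closedBall w₀ ρ, w ∈ S := by
    intro w hw
    rw [mem_closedBall_iff_norm] at hw
    have h1 := norm_sub_norm_le w₀ w
    rw [norm_sub_rev] at h1
    have h2 := norm_sub_norm_le w w₀
    exact ⟨by linarith [min_le_left (‖w₀‖ - r) (R - ‖w₀‖)],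
      by linarith [min_le_right (‖w₀‖ - r) (R - ‖w₀‖)]⟩
  -- On |w - w₀| = ρ one has |w|² = ρ² - |w₀|² + 2 Re(w̄₀ w), so φ is harmonic and equals v - Ψ(w₀)
  -- + Ψ there; at the centre it is v - ερ² < v.
  set F : ℂ → ℂ := fun w =>
    ((v - Ψ w₀ + A + ε * (R ^ 2 - ρ ^ 2 + ‖w₀‖ ^ 2) : ℝ) : ℂ)
      - ((2 * ε : ℝ) : ℂ) * (starRingEnd ℂ w₀ * w) with hF
  set φ : ℂ → ℝ := fun w => B * Real.log ‖w‖ + (F w).re with hφ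
  have hharm : HarmonicOnNhd φ (Metric.closedBall w₀ ρ) := by
    intro w hw
    refine HarmonicAt.add ?_ ?_
    · exact HarmonicAt.const_smul (c := B)
        ((analyticAt_id).harmonicAt_log_norm (hne0 w (hball w hw)))
    · refine AnalyticAt.harmonicAt_re ?_
      simp only [hF]
      fun_prop
  have hre : ∀ w : ℂ, (F w).re = v - Ψ w₀ + A + ε * (R ^ 2 - ρ ^ 2 + ‖w₀‖ ^ 2)
      - 2 * ε * (w₀.re * w.re + w₀.im * w.im) := by
    intro w
    simp only [hF, Complex.sub_re, Complex.ofReal_re, Complex.ofReal_im, Complex.mul_re,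
      Complex.conj_re, Complex.conj_im]
    ring
  have hsq : ∀ w : ℂ, ‖w‖ ^ 2 = w.re * w.re + w.im * w.im := fun w => by
    rw [← Complex.normSq_eq_norm_sq, Complex.normSq_apply]
  have hfin := hu.le_harmonic z hρ0 (fun w hw => hD w (hball w hw).1 (hball w hw).2) hharm
    (fun w hw => by
      refine (hle w (hball w (Metric.sphere_subset_closedBall hw))).trans
        (EReal.coe_le_coe_iff.2 (le_of_eq ?_))
      have h1 : ‖w - w₀‖ ^ 2 = ρ ^ 2 := by rw [mem_sphere_iff_norm.1 hw]
      rw [hsq, Complex.sub_re, Complex.sub_im] at h1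
      simp only [hφ, hre]
      have h2 := hsq w₀
      have h3 : Ψ w = A + B * Real.log ‖w‖ + ε * (R ^ 2 - (w.re * w.re + w.im * w.im)) := by
        rw [← hsq]
      rw [h3, h2, ← h1]
      ring)
  rw [hv, EReal.coe_le_coe_iff] at hfin
  simp only [hφ, hre] at hfin
  have h2 := hsq w₀
  have h3 : Ψ w₀ = A + B * Real.log ‖w₀‖ + ε * (R ^ 2 - ‖w₀‖ ^ 2) := rfl
  have h4 : 0 < ε * ρ ^ 2 := by positivity
  rw [← h2] at hfin
  nlinarith

/-! ### Identification of the two Green functions. -/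

variable {n : ℕ} {D : Set (Fin n → ℂ)} {h : (Fin n → ℂ) → ℝ}

/-- On the line through z, u is compared with s log(|ζ|/R) where s < 1: near 0 the logarithmic pole
of u lies below this. With R = h(z)^(-s) the disc |ζ| ≤ R stays in D, and ζ = 1 gives s² log h(z);
then s → 1. -/
theorem IsReinhardtGauge.greenClass_le (H : IsReinhardtGauge D h) {u : (Fin n → ℂ) → EReal}
    (hu : u ∈ greenClass D 0) {z : Fin n → ℂ} (hz : z ∈ D) (hz0 : z ≠ 0) :
    u z ≤ (Real.log (h z) : EReal) := by
  obtain ⟨hpsh, hneg, C, hC⟩ := hu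
  have hh := H.pos z hz0
  have hh1 := (H.lt_one_iff z).2 hz
  have hl : Real.log (h z) < 0 := Real.log_neg hh hh1
  have hz' : 0 < ‖z‖ := norm_pos_iff.2 hz0
  have key : ∀ s ∈ Ioo (0 : ℝ) 1, u z ≤ ((s * (s * Real.log (h z)) : ℝ) : EReal) := by
    rintro s ⟨hs0, hs1⟩
    set R := Real.exp (-(s * Real.log (h z))) with hR
    have hlogR : Real.log R = -(s * Real.log (h z)) := Real.log_exp _
    have hsl : s * Real.log (h z) < 0 := mul_neg_of_pos_of_neg hs0 hl
    have hR1 : 1 ≤ R := Real.one_le_exp (by linarith)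
    have hRh : R * h z < 1 := by
      rw [← Real.log_neg_iff (by positivity), Real.log_mul (Real.exp_pos _).ne' hh.ne', hlogR]
      nlinarith
    obtain ⟨η, hη, hball⟩ := Metric.eventually_nhds_iff.1 (eventually_nhdsWithin_iff.1 hC)
    obtain ⟨r, hr0, hr1, hrη, hrlog⟩ : ∃ r : ℝ, 0 < r ∧ r < 1 ∧ r < η / ‖z‖ ∧
        Real.log r < (-(s * Real.log R) - C - Real.log ‖z‖) / (1 - s) := by
      have h1 : ∀ᶠ r in 𝓝[>] (0 : ℝ), r ∈ Ioo (0 : ℝ) (min 1 (η / ‖z‖)) :=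
        Ioo_mem_nhdsGT (lt_min one_pos (by positivity))
      have h2 := Real.tendsto_log_nhdsGT_zero.eventually
        (eventually_lt_atBot ((-(s * Real.log R) - C - Real.log ‖z‖) / (1 - s)))
      obtain ⟨r, h3, h4⟩ := (h1.and h2).exists
      exact ⟨r, h3.1, h3.2.trans_le (min_le_left _ _), h3.2.trans_le (min_le_right _ _), h4⟩
    rw [lt_div_iff₀ (by linarith)] at hrlog
    rw [lt_div_iff₀ hz'] at hrη
    have hmem : ∀ ζ : ℂ, ‖ζ‖ ≤ R → ζ • z ∈ D := by
      intro ζ hζ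
      rw [← H.lt_one_iff, H.smul]
      exact (mul_le_mul_of_nonneg_right hζ hh.le).trans_lt hRh
    have h1 := hpsh.le_on_annulus z (r := r) (R := R) (A := -(s * Real.log R)) (B := s) hr0
      (fun ζ _ hζ => hmem ζ hζ)
      (fun ζ hζ => by
        have hnorm : ‖ζ • z‖ = r * ‖z‖ := by rw [norm_smul, hζ]
        have hne : ζ • z ≠ 0 := by
          rw [← norm_pos_iff, hnorm]
          positivity
        have h2 := hball (y := ζ • z) (by rwa [dist_zero_right, hnorm]) hne
        rw [sub_zero, hnorm, Real.log_mul hr0.ne' hz'.ne'] at h2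
        refine h2.trans (EReal.coe_le_coe_iff.2 ?_)
        linarith)
      (fun ζ hζ => by
        have h2 := hneg _ (hmem ζ hζ.le)
        simpa using h2.le)
      1 (by simpa using hr1.le) (by simpa using hR1)
    simpa [hlogR] using h1
  have ht : Tendsto (fun s : ℝ => ((s * (s * Real.log (h z)) : ℝ) : EReal)) (𝓝[<] 1)
      (𝓝 ((1 * (1 * Real.log (h z)) : ℝ) : EReal)) := by
    refine (continuous_coe_real_ereal.tendsto _).comp (Tendsto.mono_left ?_ nhdsWithin_le_nhds)
    exact Continuous.tendsto (f := fun s : ℝ => s * (s * Real.log (h z))) (by fun_prop) 1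
  rw [one_mul, one_mul] at ht
  refine ge_of_tendsto ht ?_
  filter_upwards [Ioo_mem_nhdsLT (zero_lt_one' ℝ)] with s hs using key s hs

/-- The comparison function is s log(|ζ| h(z)) with s > 1: it vanishes where ζz reaches the boundary
of D and outgrows the Lelong bound for large |ζ|; then s → 1. -/
theorem IsReinhardtGauge.lelongClass_le (H : IsReinhardtGauge D h) {u : (Fin n → ℂ) → EReal}
    (hu : u ∈ lelongClass n) (hu0 : ∀ w ∈ closure D, u w ≤ 0) {z : Fin n → ℂ} (hz : 1 < h z) :
    u z ≤ (Real.log (h z) : EReal) := by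
  obtain ⟨hpsh, C, hC⟩ := hu
  have hh : 0 < h z := one_pos.trans hz
  have key : ∀ s : ℝ, 1 < s → u z ≤ ((s * Real.log (h z) : ℝ) : EReal) := by
    intro s hs
    obtain ⟨R, hR1, hRlog⟩ : ∃ R : ℝ, 1 ≤ R ∧
        (C + Real.log (1 + ‖z‖) - s * Real.log (h z)) / (s - 1) ≤ Real.log R :=
      ((eventually_ge_atTop 1).and (Real.tendsto_log_atTop.eventually_ge_atTop _)).exists
    rw [div_le_iff₀ (by linarith)] at hRlog
    have hR0 : 0 < R := one_pos.trans_le hR1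
    have h1 := hpsh.le_on_annulus z (r := (h z)⁻¹) (R := R) (A := s * Real.log (h z)) (B := s)
      (inv_pos.2 hh) (fun _ _ _ => mem_univ _)
      (fun ζ hζ => by
        have h2 : ζ • z ∈ closure D := by
          rw [H.closure_eq]
          change h (ζ • z) ≤ 1
          rw [H.smul, hζ, inv_mul_cancel₀ hh.ne']
        simpa using hu0 _ h2)
      (fun ζ hζ => by
        refine (hC _).trans (EReal.coe_le_coe_iff.2 ?_)
        have h2 : Real.log (1 + ‖ζ • z‖) ≤ Real.log R + Real.log (1 + ‖z‖) := by
          rw [← Real.log_mul hR0.ne' (by positivity), norm_smul, hζ]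
          refine Real.log_le_log (by positivity) ?_
          nlinarith [norm_nonneg z]
        linarith)
      1 (by simpa using inv_le_one_of_one_le₀ hz.le) (by simpa using hR1)
    simpa using h1
  have ht : Tendsto (fun s : ℝ => ((s * Real.log (h z) : ℝ) : EReal)) (𝓝[>] 1)
      (𝓝 ((1 * Real.log (h z) : ℝ) : EReal)) := by
    refine (continuous_coe_real_ereal.tendsto _).comp (Tendsto.mono_left ?_ nhdsWithin_le_nhds)
    exact Continuous.tendsto (f := fun s : ℝ => s * Real.log (h z)) (by fun_prop) 1
  rw [one_mul] at ht
  refine ge_of_tendsto ht ?_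
  filter_upwards [self_mem_nhdsWithin] with s hs using key s hs

/-- Logarithms of monomials, which are plurisubharmonic, approximate `log h` from below. -/
theorem IsReinhardtGauge.exists_logMonomial (H : IsReinhardtGauge D h)
    (hbdd : Bornology.IsBounded D) (hpc : IsPolynomiallyConvex D) {z : Fin n → ℂ} (hz : z ≠ 0)
    {κ : ℝ} (hκ : 1 < κ) :
    ∃ u : (Fin n → ℂ) → EReal, (∀ E, PSHOn u E) ∧ u 0 = ⊥ ∧
      (∀ w, w ≠ 0 → u w ≤ (Real.log (h w) : EReal)) ∧
      ((Real.log (h z) - Real.log κ : ℝ) : EReal) ≤ u z := by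
  have hκ0 : 0 < κ := one_pos.trans hκ
  obtain ⟨N, q, c, A, hq, hc, hA, hlow, hup⟩ := H.exists_monomialNorm_family hbdd hpc hκ
  obtain ⟨j, hj⟩ := hlow z hz
  have hq' : (0 : ℝ) < q := Nat.cast_pos.2 hq
  have hh := H.pos z hz
  -- Dividing by κ^q brings the monomial below h^q at the cost of log κ.
  have hc' : 0 < c j / κ ^ q := div_pos (hc j) (by positivity)
  have hmon : ∀ w, monomialNorm (c j / κ ^ q) (A j) w
      = monomialNorm (c j) (A j) w / κ ^ q := fun w => by
    unfold monomialNorm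
    ring
  have hle : ∀ w, monomialNorm (c j / κ ^ q) (A j) w ≤ h w ^ q := by
    intro w
    rw [hmon, div_le_iff₀ (by positivity), ← mul_pow, mul_comm]
    exact hup j w
  refine ⟨logMonomial (q : ℝ)⁻¹ (c j / κ ^ q) (A j),
    fun E => pshOn_logMonomial (inv_pos.2 hq') hc' _ E, ?_, fun w hw => ?_, ?_⟩
  · have h0 : monomialNorm (c j / κ ^ q) (A j) (0 : Fin n → ℂ) = 0 := by
      refine le_antisymm ?_ (monomialNorm_nonneg hc'.le _ _)
      simpa [H.map_zero, hq.ne'] using hle 0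
    rw [logMonomial, h0, Real.zero_rpow (inv_pos.2 hq').ne', ENNReal.ofReal_zero, ENNReal.log_zero]
  · exact logMonomial_le hq hc' (H.pos w hw) (hle w)
  · have h1 : (h z / κ) ^ q < monomialNorm (c j / κ ^ q) (A j) z := by
      rw [hmon, div_pow]
      gcongr
    have h2 : 0 < (h z / κ) ^ q := by positivity
    rw [logMonomial_eq (h2.trans h1), EReal.coe_le_coe_iff, ← Real.log_div hh.ne' hκ0.ne',
      le_inv_mul_iff₀ hq', ← Real.log_pow]
    exact Real.log_le_log h2 h1.le

theorem le_of_forall_log_sub_le {x : ℝ} {y : EReal}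
    (hxy : ∀ κ : ℝ, 1 < κ → ((x - Real.log κ : ℝ) : EReal) ≤ y) : (x : EReal) ≤ y := by
  have ht : Tendsto (fun κ : ℝ => ((x - Real.log κ : ℝ) : EReal)) (𝓝[>] 1)
      (𝓝 ((x - Real.log 1 : ℝ) : EReal)) := by
    refine (continuous_coe_real_ereal.tendsto _).comp (Tendsto.mono_left ?_ nhdsWithin_le_nhds)
    exact tendsto_const_nhds.sub (Real.continuousAt_log one_ne_zero)
  rw [Real.log_one, sub_zero] at ht
  refine le_of_tendsto ht ?_
  filter_upwards [self_mem_nhdsWithin] with κ hκ using hxy κ hκ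

theorem IsReinhardtGauge.exists_log_le (H : IsReinhardtGauge D h) :
    ∃ C : ℝ, ∀ z, z ≠ 0 → Real.log (h z) ≤ Real.log ‖z‖ + C := by
  obtain ⟨C, hC0, hC⟩ := H.exists_le
  refine ⟨Real.log C, fun z hz => ?_⟩
  rw [add_comm, ← Real.log_mul hC0.ne' (norm_ne_zero_iff.2 hz)]
  exact Real.log_le_log (H.pos z hz) (hC z)

/-- The Green function with pole at the origin is the logarithm of the Minkowski functional. -/
theorem IsReinhardtGauge.greenFunction_eq (H : IsReinhardtGauge D h)
    (hbdd : Bornology.IsBounded D) (hpc : IsPolynomiallyConvex D) {z : Fin n → ℂ} (hz : z ∈ D)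
    (hz0 : z ≠ 0) : greenFunction D 0 z = (Real.log (h z) : EReal) := by
  refine le_antisymm (iSup₂_le fun u hu => H.greenClass_le hu hz hz0)
    (le_of_forall_log_sub_le fun κ hκ => ?_)
  obtain ⟨u, hpsh, hu0, hule, huz⟩ := H.exists_logMonomial hbdd hpc hz0 hκ
  refine huz.trans (le_iSup₂_of_le u ⟨hpsh D, fun w hw => ?_, ?_⟩ le_rfl)
  · rcases eq_or_ne w 0 with rfl | hw0
    · rw [hu0]
      exact EReal.bot_lt_zero
    · refine (hule w hw0).trans_lt ?_
      exact_mod_cast Real.log_neg (H.pos w hw0) ((H.lt_one_iff w).2 hw)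
  · obtain ⟨C, hC⟩ := H.exists_log_le
    refine ⟨C, ?_⟩
    filter_upwards [self_mem_nhdsWithin] with w hw
    rw [sub_zero]
    exact (hule w hw).trans (EReal.coe_le_coe_iff.2 (hC w hw))

theorem pshOn_zero (E : Set (Fin n → ℂ)) : PSHOn (fun _ => (0 : EReal)) E := by
  refine ⟨fun _ _ => EReal.zero_lt_top, upperSemicontinuousOn_const, fun a b _ => ?_⟩
  simp [circleMean]

/-- The Green function with pole at infinity is the positive part of the logarithm of the
Minkowski functional. -/
theorem IsReinhardtGauge.greenFunctionInfty_eq (H : IsReinhardtGauge D h)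
    (hbdd : Bornology.IsBounded D) (hpc : IsPolynomiallyConvex D) (z : Fin n → ℂ) :
    greenFunctionInfty (closure D) z = ((max (Real.log (h z)) 0 : ℝ) : EReal) := by
  have hnonneg : 0 ≤ greenFunctionInfty (closure D) z := by
    refine le_iSup₂_of_le (f := fun (u : (Fin n → ℂ) → EReal) _ => u z) (fun _ => 0)
      ⟨⟨pshOn_zero _, 0, fun w => ?_⟩, fun _ _ => le_rfl⟩ le_rfl
    rw [add_zero]
    exact EReal.coe_nonneg.2 (Real.log_nonneg (by linarith [norm_nonneg w]))
  rcases le_or_gt (h z) 1 with hz | hz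
  · rw [max_eq_right (Real.log_nonpos (H.nonneg z) hz)]
    refine le_antisymm (iSup₂_le fun u hu => hu.2 z ?_) hnonneg
    rw [H.closure_eq]
    exact hz
  · have hz0 : z ≠ 0 := by
      rintro rfl
      rw [H.map_zero] at hz
      linarith
    rw [max_eq_left (Real.log_nonneg hz.le)]
    refine le_antisymm (iSup₂_le fun u hu => H.lelongClass_le hu.1 hu.2 hz)
      (le_of_forall_log_sub_le fun κ hκ => ?_)
    obtain ⟨u, hpsh, hu0, hule, huz⟩ := H.exists_logMonomial hbdd hpc hz0 hκ
    refine huz.trans (le_iSup₂_of_le (f := fun (u : (Fin n → ℂ) → EReal) _ => u z) u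
      ⟨⟨hpsh _, ?_⟩, fun w hw => ?_⟩ le_rfl)
    · obtain ⟨C, hC⟩ := H.exists_log_le
      refine ⟨C, fun w => ?_⟩
      rcases eq_or_ne w 0 with rfl | hw0
      · rw [hu0]
        exact bot_le
      · refine (hule w hw0).trans (EReal.coe_le_coe_iff.2 ((hC w hw0).trans ?_))
        have := Real.log_le_log (norm_pos_iff.2 hw0) (le_add_of_nonneg_left zero_le_one)
        linarith
    · rcases eq_or_ne w 0 with rfl | hw0
      · rw [hu0]
        exact bot_le
      · refine (hule w hw0).trans ?_
        rw [H.closure_eq] at hw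
        exact_mod_cast Real.log_nonpos (H.nonneg w) hw

/-! ### Uniform convergence and conclusion. -/

/-- Two-sided bounds for `max_k |P_k|` give two-sided bounds for its logarithm. -/
theorem exists_logMax_eq {q : ℕ} (hq : 0 < q) {P : Fin n → MvPolynomial (Fin n) ℂ}
    {z : Fin n → ℂ} {a b : ℝ} (ha : 0 < a) (hb : 0 < b)
    (hlow : ∃ k, a ^ q ≤ ‖MvPolynomial.eval z (P k)‖)
    (hup : ∀ k, ‖MvPolynomial.eval z (P k)‖ ≤ b ^ q) :
    ∃ x : ℝ, logMax q P z = x ∧ Real.log a ≤ x ∧ x ≤ Real.log b := by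
  have hq' : (0 : ℝ) < q := Nat.cast_pos.2 hq
  set s : EReal := ⨆ k, ENNReal.log ‖MvPolynomial.eval z (P k)‖ₑ with hs
  have hlog : ∀ t : ℝ, 0 < t →
      ENNReal.log (ENNReal.ofReal (t ^ q)) = ((q * Real.log t : ℝ) : EReal) := fun t ht => by
    rw [ENNReal.log_ofReal_of_pos (by positivity), Real.log_pow]
  have h1 : ((q * Real.log a : ℝ) : EReal) ≤ s := by
    obtain ⟨k, hk⟩ := hlow
    refine le_iSup_of_le k ?_
    rw [← hlog a ha, ← ofReal_norm]
    exact ENNReal.log_monotone (ENNReal.ofReal_le_ofReal hk)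
  have h2 : s ≤ ((q * Real.log b : ℝ) : EReal) := by
    refine iSup_le fun k => ?_
    rw [← hlog b hb, ← ofReal_norm]
    exact ENNReal.log_monotone (ENNReal.ofReal_le_ofReal (hup k))
  have h3 : s ≠ ⊤ := (h2.trans_lt (EReal.coe_lt_top _)).ne
  have h4 : s ≠ ⊥ := ((EReal.bot_lt_coe _).trans_le h1).ne'
  rw [← EReal.coe_toReal h3 h4, EReal.coe_le_coe_iff] at h1 h2
  refine ⟨(q : ℝ)⁻¹ * s.toReal, ?_, (le_inv_mul_iff₀ hq').2 h1, (inv_mul_le_iff₀ hq').2 h2⟩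
  rw [EReal.coe_mul, EReal.coe_toReal h3 h4]
  rfl

theorem logMax_zero {q : ℕ} (hq : 0 < q) {P : Fin n → MvPolynomial (Fin n) ℂ}
    (hP : ∀ k, MvPolynomial.eval 0 (P k) = 0) : logMax q P 0 = ⊥ := by
  have hq' : (0 : ℝ) < (q : ℝ)⁻¹ := inv_pos.2 (Nat.cast_pos.2 hq)
  simp only [logMax, hP, enorm_zero, ENNReal.log_zero, iSup_bot]
  exact EReal.coe_mul_bot_of_pos hq'

theorem convergesUniformlyOn_of_abs_sub_le {X : Type*} {f : ℕ → X → EReal} {g : X → EReal}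
    {S : Set X} {ε : ℕ → ℝ} (hε : Tendsto ε atTop (𝓝 0))
    (hfg : ∀ s, ∀ z ∈ S, ∃ x y : ℝ, f s z = x ∧ g z = y ∧ |x - y| ≤ ε s) :
    ConvergesUniformlyOn f g S := by
  refine ⟨fun z hz => ?_, fun s z hz => ?_, ?_⟩
  · obtain ⟨x, y, -, hy, -⟩ := hfg 0 z hz
    rw [hy]
    exact ⟨EReal.coe_ne_top y, EReal.coe_ne_bot y⟩
  · obtain ⟨x, y, hx, -, -⟩ := hfg s z hz
    rw [hx]
    exact ⟨EReal.coe_ne_top x, EReal.coe_ne_bot x⟩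
  · rw [Metric.tendstoUniformlyOn_iff]
    intro δ hδ
    filter_upwards [hε.eventually (gt_mem_nhds hδ)] with s hs z hz
    obtain ⟨x, y, hx, hy, hxy⟩ := hfg s z hz
    rw [hx, hy, EReal.toReal_coe, EReal.toReal_coe, dist_comm, Real.dist_eq]
    exact hxy.trans_lt hs

end PluriGreen

theorem theorem1 (n : ℕ) (hn : 1 ≤ n) (D : Set (Fin n → ℂ))
    (hopen : IsOpen D) (hconn : IsConnected D) (hbdd : Bornology.IsBounded D)
    (hpc : PluriGreen.IsPolynomiallyConvex D) (hR : PluriGreen.IsReinhardt D) :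
    ∃ (q : ℕ → ℕ) (P : ℕ → Fin n → MvPolynomial (Fin n) ℂ),
      (∀ s, 0 < q s) ∧
      (∀ s k, (P s k).IsHomogeneous (q s)) ∧
      (∀ s z, (∀ k, MvPolynomial.eval z (P s k) = 0) ↔ z = 0) ∧
      PluriGreen.ConvergesUniformlyOn (fun s => PluriGreen.logMax (q s) (P s))
        (PluriGreen.greenFunction D 0) (D \ {0}) ∧
      PluriGreen.ConvergesUniformlyOn (fun s z => max (PluriGreen.logMax (q s) (P s) z) 0)
        (PluriGreen.greenFunctionInfty (closure D)) univ := by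
  have H := PluriGreen.isReinhardtGauge_gauge hopen hconn.nonempty hbdd
    fun z hz w hw => hpc.mem_of_norm_le hR hz hw
  set h := gauge D
  set κ : ℕ → ℝ := fun s => 1 + 1 / ((s : ℝ) + 1) with hκdef
  have hκ : ∀ s, 1 < κ s := fun s => by
    have : (0 : ℝ) < 1 / ((s : ℝ) + 1) := by positivity
    simp only [hκdef]
    linarith
  have hκ0 : ∀ s, 0 < κ s := fun s => one_pos.trans (hκ s)
  choose q P hq hhom hlow hup using fun s => by
    simpa only [forall_and] using H.exists_polynomials hn hbdd hpc (hκ s)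
  -- The factors κ⁻¹ and κ³ shift the logarithm by at most 3 log κ, independently of z.
  have hbound : ∀ s z, z ≠ 0 → ∃ x : ℝ, PluriGreen.logMax (q s) (P s) z = x ∧
      |x - Real.log (h z)| ≤ 3 * Real.log (κ s) := by
    intro s z hz
    have hh := H.pos z hz
    have hk := hκ0 s
    obtain ⟨x, hx, h1, h2⟩ := PluriGreen.exists_logMax_eq (hq s) (by positivity) (by positivity)
      (hlow s z) (hup s z)
    refine ⟨x, hx, ?_⟩
    rw [Real.log_mul (by positivity) hh.ne', Real.log_inv] at h1
    rw [Real.log_mul (by positivity) hh.ne', Real.log_pow] at h2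
    push_cast at h2
    have h3 := Real.log_pos (hκ s)
    rw [abs_le]
    constructor <;> linarith
  have hzero : ∀ s k, MvPolynomial.eval 0 (P s k) = 0 := by
    intro s k
    have h1 := hup s 0 k
    rw [H.map_zero, mul_zero, zero_pow (hq s).ne'] at h1
    exact norm_le_zero_iff.1 h1
  have hε : Tendsto (fun s => 3 * Real.log (κ s)) atTop (𝓝 0) := by
    have h1 : Tendsto κ atTop (𝓝 (1 + 0)) :=
      tendsto_const_nhds.add tendsto_one_div_add_atTop_nhds_zero_nat
    rw [add_zero] at h1
    have h2 := ((Real.continuousAt_log one_ne_zero).tendsto.comp h1).const_mul 3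
    rwa [Real.log_one, mul_zero] at h2
  refine ⟨q, P, hq, hhom, fun s z => ⟨fun hz => ?_, ?_⟩,
    PluriGreen.convergesUniformlyOn_of_abs_sub_le hε fun s z hz => ?_,
    PluriGreen.convergesUniformlyOn_of_abs_sub_le hε fun s z _ => ?_⟩
  · by_contra hz0
    obtain ⟨k, hk⟩ := hlow s z
    rw [hz k, norm_zero] at hk
    exact absurd hk (not_le.2 (pow_pos (mul_pos (inv_pos.2 (hκ0 s)) (H.pos z hz0)) _))
  · rintro rfl
    exact hzero s
  · obtain ⟨x, hx, hxle⟩ := hbound s z hz.2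
    exact ⟨x, _, hx, H.greenFunction_eq hbdd hpc hz.1 hz.2, hxle⟩
  · rcases eq_or_ne z 0 with rfl | hz0
    -- At the origin `logMax` is -∞, but its maximum with 0 is 0; `Real.log 0 = 0` makes the formula
    -- for V give 0 as well.
    · refine ⟨0, _, ?_, H.greenFunctionInfty_eq hbdd hpc 0, ?_⟩
      · rw [PluriGreen.logMax_zero (hq s) (hzero s)]
        simp
      · rw [H.map_zero, Real.log_zero, max_self, sub_zero, abs_zero]
        exact mul_nonneg zero_le_three (Real.log_nonneg (hκ s).le)
    · obtain ⟨x, hx, hxle⟩ := hbound s z hz0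
      refine ⟨max x 0, _, ?_, H.greenFunctionInfty_eq hbdd hpc z,
        (abs_max_sub_max_le_abs x (Real.log (h z)) 0).trans hxle⟩
      rw [hx, EReal.coe_strictMono.monotone.map_max, EReal.coe_zero]
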